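/- Let $\mathcal H$ be a finite-dimensional real Hilbert space, $\mathcal Y$ a real Banach space, $m\ge 1$, and equip $\mathcal H\times\mathbb R^m$ with the product Hilbert norm. Let $\mathcal K\subset\mathcal Y$ be a nonempty convex cone, $\mathcal K^+=\{v^*\in\mathcal Y^*:\langle v^*,y\rangle\ge 0\ \forall y\in\mathcal K\}$, and let $\mathcal C\subset\mathcal Y^*$ be a weak$^*$-compact convex set with $\operatorname{cl}^{w^*}\{t v^*: t\ge 0,\ v^*\in\mathcal C\}=\mathcal K^+$. Let $\Phi:\mathcal H\times\mathbb R^m\to\mathcal Y$ be a map and $h:\mathcal H\to\mathbb R$ a continuously differentiable convex function such that for every $v^*\in\mathcal C$ the function $\Phi^h_{v^*}(x,z):=\langle v^*,\Phi(x,z)\rangle+h(x)$ is convex on $\mathcal H\times\mathbb R^m$. Put $S(x,z):=\sup_{v^*\in\mathcal C}\Phi^h_{v^*}(x,z)$. For $\lambda>0$ and a convex function $\psi:\mathcal H\times\mathbb R^m\to\mathbb R$ let $$e_\lambda\psi(w):=\inf_{y}\Big(\psi(y)+\tfrac1{2\lambda}\|w-y\|^2\Big),\qquad \operatorname{Prox}_\lambda\psi(w):=\operatorname*{argmin}_{y}\Big(\psi(y)+\tfrac1{2\lambda}\|w-y\|^2\Big)$$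 be its Moreau envelope and its proximal point at $w$, and set $E_\lambda:=e_\lambda S$. Let $\xi:\Omega\to\mathbb R^m$ be a random vector on a probability space $(\Omega,\mathcal F,\mathbb P)$ with a continuous density $f_\xi\ge 0$ with respect to Lebesgue measure, and define $$\varphi_\lambda(x):=\mathbb P\big(\omega\in\Omega: E_\lambda(x,\xi(\omega))\le h(x)\big).$$ Let $L$ be a nonsingular real $m\times m$ matrix, $\mathbb S^{m-1}$ the Euclidean unit sphere of $\mathbb R^m$, and $\mu_\zeta$ the uniform probability measure on $\mathbb S^{m-1}$. Define $$\theta(r,v):=\frac{2\pi^{m/2}|\det L|}{\Gamma(m/2)}\,r^{m-1}f_\xi(rLv),\qquad F_\lambda(x):=\{v\in\mathbb S^{m-1}:\exists r>0,\ E_\lambda(x,rLv)=h(x)\},$$ $$\rho_\lambda(x,v):=\sup\{r>0: E_\lambda(x,rLv)\le h(x)\}\in[0,+\infty],$$ $$G_\lambda(x,v):=\begin{cases}-\theta(\rho_\lambda(x,v),v)\,\dfrac{\nabla_xE_\lambda(x,\rho_\lambda(x,v)Lv)-\nabla h(x)}{\langle\nabla_zE_\lambda(x,\rho_\lambda(x,v)Lv),Lv\rangle}&\text{if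 }v\in F_\lambda(x),\\[2mm]0&\text{if }v\in\mathbb S^{m-1}\setminus F_\lambda(x).\end{cases}$$ Let $\bar x\in\mathcal H$ satisfy $S(\bar x,0)<h(\bar x)$, and assume that $\lim_{\|z\|\to+\infty}\|z\|^{m+1}f_\xi(z)=0$. Then for every $\lambda>0$: 1. There is an open neighbourhood $U$ of $\bar x$ such that $E_\lambda(x,0)<h(x)$ for all $x\in U$, the function $\varphi_\lambda$ is continuously differentiable on $U$, and for all $x\in U$ the map $G_\lambda(x,\cdot)$ is $\mu_\zeta$-integrable and $$\nabla\varphi_\lambda(x)=\int_{\mathbb S^{m-1}}G_\lambda(x,v)\,d\mu_\zeta(v).$$ 2. For every $(x,z)\in\mathcal H\times\mathbb R^m$ there is an active vector at $(x,z)$, that is, some $v^*\in\mathcal C$ with $e_\lambda\Phi^h_{v^*}(x,z)=E_\lambda(x,z)$; and for every active vector $v^*$ at $(x,z)$ the proximal point of $\Phi^h_{v^*}$ at $(x,z)$ exists and is unique, $E_\lambda$ is differentiable at $(x,z)$, and $$\nabla E_\lambda(x,z)=\frac{(x,z)-\operatorname{Prox}_\lambda\Phi^h_{v^*}(x,z)}{\lambda}.$$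 -/

import Mathlib

open MeasureTheory Set Filter Topology

noncomputable section

namespace ChanceMoreau

/-- `ℝ^m` with its Euclidean structure. -/
abbrev Euc (m : ℕ) : Type := EuclideanSpace ℝ (Fin m)

/-- The unit sphere `𝕊^{m-1}` of `ℝ^m`. -/
abbrev Sph (m : ℕ) : Type := Metric.sphere (0 : Euc m) 1

/-- The Hilbert product `H × ℝ^m`, with `‖(x, z)‖² = ‖x‖² + ‖z‖²`. -/
abbrev Prod2 (H : Type*) (m : ℕ) : Type _ := WithLp 2 (H × Euc m)

/-- The element `(x, z)` of `H × ℝ^m`. -/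
abbrev pair {H : Type*} {m : ℕ} (x : H) (z : Euc m) : Prod2 H m := WithLp.toLp 2 (x, z)

section Cones

variable {Y : Type*} [NormedAddCommGroup Y] [NormedSpace ℝ Y]

/-- The positive dual cone `K⁺ = {v* : ⟨v*, y⟩ ≥ 0 for all y ∈ K}`. -/
def posDual (K : Set Y) : Set (WeakDual ℝ Y) := {v | ∀ y ∈ K, 0 ≤ v y}

/-- The cone `{t v* : t ≥ 0, v* ∈ C}` generated by a set `C` of functionals (a convex cone when
`C` is convex, which is the only case used). It is empty for `C = ∅`. -/
def coneOf (C : Set (WeakDual ℝ Y)) : Set (WeakDual ℝ Y) :=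
  {w | ∃ t : ℝ, 0 ≤ t ∧ ∃ v ∈ C, w = t • v}

end Cones

section Moreau

variable {X : Type*} [NormedAddCommGroup X]

/-- The Moreau envelope of `ψ` with parameter `lam`. The infimum is over a set bounded below
whenever `ψ` has an affine minorant, as a real-valued convex function on a finite-dimensional
space does. -/
def moreau (lam : ℝ) (ψ : X → ℝ) (x : X) : ℝ :=
  ⨅ y : X, (ψ y + 1 / (2 * lam) * ‖x - y‖ ^ 2)

/-- The set of minimizers that defines the proximal point of `ψ` of index `lam` at `x`. -/
def proxSet (lam : ℝ) (ψ : X → ℝ) (x : X) : Set X :=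
  {p | ∀ y : X, ψ p + 1 / (2 * lam) * ‖x - p‖ ^ 2 ≤ ψ y + 1 / (2 * lam) * ‖x - y‖ ^ 2}

end Moreau

section Scalarization

variable {H Y : Type*} [NormedAddCommGroup Y] [NormedSpace ℝ Y] {m : ℕ}

/-- The scalarization `Φ_{v*}^h (x, z) = ⟨v*, Φ(x, z)⟩ + h(x)`. -/
def scal (Φ : H → Euc m → Y) (h : H → ℝ) (v : WeakDual ℝ Y) (w : Prod2 H m) : ℝ :=
  v (Φ w.fst w.snd) + h w.fst

/-- The supremum function `S^h_Φ (x, z) = sup_{v* ∈ C} Φ_{v*}^h (x, z)`. -/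
def supFun (Φ : H → Euc m → Y) (h : H → ℝ) (C : Set (WeakDual ℝ Y)) (w : Prod2 H m) : ℝ :=
  ⨆ v : C, scal Φ h v w

/-- The Moreau envelope of the supremum function. -/
def supEnv [NormedAddCommGroup H] (Φ : H → Euc m → Y) (h : H → ℝ) (C : Set (WeakDual ℝ Y))
    (lam : ℝ) : Prod2 H m → ℝ :=
  moreau lam (supFun Φ h C)

/-- The regularized probability function
`φ_λ(x) = P(ω : (Moreau envelope of S^h_Φ)(x, ξ(ω)) ≤ h(x))`. -/
def regProb [NormedAddCommGroup H] {Ω : Type*} [MeasurableSpace Ω] (P : Measure Ω)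
    (ξ : Ω → Euc m) (Φ : H → Euc m → Y) (h : H → ℝ) (C : Set (WeakDual ℝ Y)) (lam : ℝ)
    (x : H) : ℝ :=
  P.real {ω | supEnv Φ h C lam (pair x (ξ ω)) ≤ h x}

end Scalarization

section Spherical

variable {m : ℕ}

/-- The uniform probability measure on the unit sphere `𝕊^{m-1}`. -/
def sphereUnif (m : ℕ) : Measure (Sph m) :=
  ((volume : Measure (Euc m)).toSphere univ)⁻¹ • (volume : Measure (Euc m)).toSphere

/-- The point `r L v` of `ℝ^m`. -/
def ray (L : Matrix (Fin m) (Fin m) ℝ) (r : ℝ) (v : Sph m) : Euc m :=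
  r • Matrix.toEuclideanLin L (v : Euc m)

/-- The density-like function
`θ(r, v) = (2 π^{m/2} |det L| / Γ(m/2)) r^{m-1} f(r L v)`. -/
def theta (L : Matrix (Fin m) (Fin m) ℝ) (f : Euc m → ℝ) (r : ℝ) (v : Sph m) : ℝ :=
  2 * Real.pi ^ ((m : ℝ) / 2) * |L.det| / Real.Gamma ((m : ℝ) / 2) * r ^ (m - 1) * f (ray L r v)

variable {H Y : Type*} [NormedAddCommGroup H] [NormedAddCommGroup Y] [NormedSpace ℝ Y]

/-- The finite directions `F_λ(x)`; the infinite directions are the complement. -/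
def finDir (Φ : H → Euc m → Y) (h : H → ℝ) (C : Set (WeakDual ℝ Y))
    (L : Matrix (Fin m) (Fin m) ℝ) (lam : ℝ) (x : H) : Set (Sph m) :=
  {v | ∃ r : ℝ, 0 < r ∧ supEnv Φ h C lam (pair x (ray L r v)) = h x}

/-- The radial function `ρ_λ(x, v)`, possibly `+∞`. -/
def rho (Φ : H → Euc m → Y) (h : H → ℝ) (C : Set (WeakDual ℝ Y))
    (L : Matrix (Fin m) (Fin m) ℝ) (lam : ℝ) (x : H) (v : Sph m) : EReal :=
  sSup {s : EReal | ∃ r : ℝ, 0 < r ∧ supEnv Φ h C lam (pair x (ray L r v)) ≤ h x ∧ s = (r : EReal)}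

/-- The vector `-θ(r, v) (∇_x E(x, r L v) - ∇h(x)) / ⟨∇_z E(x, r L v), L v⟩`, where `E` is the
envelope of the supremum function; partial gradients are gradients of the partial maps. -/
def gradLikeAt [InnerProductSpace ℝ H] [CompleteSpace H] (Φ : H → Euc m → Y) (h : H → ℝ)
    (C : Set (WeakDual ℝ Y)) (L : Matrix (Fin m) (Fin m) ℝ) (f : Euc m → ℝ) (lam : ℝ)
    (x : H) (v : Sph m) (r : ℝ) : H :=
  (-theta L f r v /
      inner ℝ (gradient (fun z : Euc m => supEnv Φ h C lam (pair x z)) (ray L r v))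
        (Matrix.toEuclideanLin L (v : Euc m))) •
    (gradient (fun x' : H => supEnv Φ h C lam (pair x' (ray L r v))) x - gradient h x)

open Classical in
/-- The gradient-like mapping `G_λ`. On finite directions `ρ_λ(x, v)` is a real number when the
envelope at `(x, 0)` is below `h(x)`. -/
def gradLike [InnerProductSpace ℝ H] [CompleteSpace H] (Φ : H → Euc m → Y) (h : H → ℝ)
    (C : Set (WeakDual ℝ Y)) (L : Matrix (Fin m) (Fin m) ℝ) (f : Euc m → ℝ) (lam : ℝ)
    (x : H) (v : Sph m) : H :=
  if v ∈ finDir Φ h C L lam x then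
    gradLikeAt Φ h C L f lam x v (rho Φ h C L lam x v).toReal
  else 0

end Spherical

end ChanceMoreau

end

/-!
The function minimized in the envelope of `S` is convex in the primal point and concave and
upper semicontinuous in `v* ∈ C`, so a minimax theorem on a ball around the proximal point of
`S` produces an active `v*`. The proximal points of `Φ^h_{v*}` and `S` then coincide, since
`Φ^h_{v*} ≤ S` and the two envelopes agree. The variational inequality for proximal
points makes `λ⁻¹ (w - Prox w)` a Lipschitz subgradient of `E = e_λ S`, so `E` is convex and
continuously differentiable with this gradient.

Near `x̄` the sets `{z | E (x, z) ≤ h x}` are convex neighbourhoods of `0`, and their gauge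
`s (x, v)` in the direction `L v` is the reciprocal of `ρ (x, v)`, with the value `0` on the
infinite directions. Uniform slack at `z = 0` makes `s` Lipschitz in `x`, and implicit
differentiation gives its derivative wherever `s > 0`.

In polar coordinates with `t = 1 / r`,
`1 - φ x = ∫ v, ∫ t in 0..s (x, v), θ (t⁻¹, v) t⁻²`. The growth condition makes the inner
integrand extend continuously by `0` to `t = 0`. Hence the inner integral has derivative `0` at
an infinite direction although `s` need not be differentiable there, its derivative is continuous in
`(x, v)`, and one differentiates under the integral over the compact sphere.
-/

noncomputable section

namespace ChanceMoreau

section ProximalPoint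

theorem moreau_eq_of_mem_proxSet {X : Type*} [NormedAddCommGroup X] {lam : ℝ} {ψ : X → ℝ}
    {w p : X} (hp : p ∈ proxSet lam ψ w) :
    moreau lam ψ w = ψ p + 1 / (2 * lam) * ‖w - p‖ ^ 2 :=
  le_antisymm (ciInf_le ⟨_, forall_mem_range.2 hp⟩ p) (le_ciInf hp)

theorem moreau_le_self_of_mem_proxSet {X : Type*} [NormedAddCommGroup X] {lam : ℝ} {ψ : X → ℝ}
    {w p : X} (hp : p ∈ proxSet lam ψ w) : moreau lam ψ w ≤ ψ w := by
  simpa [moreau_eq_of_mem_proxSet hp] using hp w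

variable {X : Type*} [NormedAddCommGroup X] [InnerProductSpace ℝ X] {lam : ℝ} {ψ : X → ℝ}

theorem add_inner_le_of_mem_proxSet (hψ : ConvexOn ℝ univ ψ) (hlam : 0 < lam) {w p : X}
    (hp : p ∈ proxSet lam ψ w) (y : X) :
    ψ p + inner ℝ (lam⁻¹ • (w - p)) (y - p) ≤ ψ y := by
  have along_segment : ∀ t ∈ Ioo (0 : ℝ) 1,
      ψ p + inner ℝ (lam⁻¹ • (w - p)) (y - p) ≤ ψ y + t * (1 / (2 * lam) * ‖y - p‖ ^ 2) := by
    rintro t ⟨ht0, ht1⟩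
    have hmin := hp ((1 - t) • p + t • y)
    have hconv : ψ ((1 - t) • p + t • y) ≤ (1 - t) * ψ p + t * ψ y :=
      hψ.2 (mem_univ p) (mem_univ y) (by linarith) ht0.le (by ring)
    have hsq : ‖w - ((1 - t) • p + t • y)‖ ^ 2
        = ‖w - p‖ ^ 2 - 2 * t * inner ℝ (w - p) (y - p) + t ^ 2 * ‖y - p‖ ^ 2 := by
      rw [show w - ((1 - t) • p + t • y) = (w - p) - t • (y - p) by module, norm_sub_sq_real,
        inner_smul_right, norm_smul, mul_pow, Real.norm_eq_abs, sq_abs]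
      ring
    rw [hsq] at hmin
    rw [real_inner_smul_left]
    refine le_of_mul_le_mul_left ?_ ht0
    have hexpand : 1 / (2 * lam) *
          (‖w - p‖ ^ 2 - 2 * t * inner ℝ (w - p) (y - p) + t ^ 2 * ‖y - p‖ ^ 2)
        = 1 / (2 * lam) * ‖w - p‖ ^ 2 - t * (lam⁻¹ * inner ℝ (w - p) (y - p))
          + t * (t * (1 / (2 * lam) * ‖y - p‖ ^ 2)) := by
      field_simp
    linarith
  have hlim : Tendsto (fun t : ℝ => ψ y + t * (1 / (2 * lam) * ‖y - p‖ ^ 2)) (𝓝[>] 0)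
      (𝓝 (ψ y)) :=
    (Continuous.tendsto' (by fun_prop) 0 _ (by simp)).mono_left nhdsWithin_le_nhds
  exact ge_of_tendsto hlim
    (eventually_of_mem (Ioo_mem_nhdsGT one_pos) along_segment)

theorem inner_sub_prox_nonneg (hψ : ConvexOn ℝ univ ψ) (hlam : 0 < lam) {w w' p p' : X}
    (hp : p ∈ proxSet lam ψ w) (hp' : p' ∈ proxSet lam ψ w') :
    0 ≤ inner ℝ ((w - p) - (w' - p')) (p - p') := by
  have h := add_inner_le_of_mem_proxSet hψ hlam hp p'
  have h' := add_inner_le_of_mem_proxSet hψ hlam hp' p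
  rw [← neg_sub p p', inner_neg_right, real_inner_smul_left] at h
  rw [real_inner_smul_left] at h'
  refine nonneg_of_mul_nonneg_right (a := lam⁻¹) ?_ (inv_pos.2 hlam)
  rw [inner_sub_left]
  linarith

theorem proxSet_subsingleton (hψ : ConvexOn ℝ univ ψ) (hlam : 0 < lam) (w : X) :
    (proxSet lam ψ w).Subsingleton := by
  intro p hp p' hp'
  have h := inner_sub_prox_nonneg hψ hlam hp hp'
  rw [show (w - p) - (w - p') = -(p - p') by abel, inner_neg_left, neg_nonneg] at h
  exact sub_eq_zero.1 (real_inner_self_nonpos.1 h)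

theorem norm_sub_prox_le (hψ : ConvexOn ℝ univ ψ) (hlam : 0 < lam) {w w' p p' : X}
    (hp : p ∈ proxSet lam ψ w) (hp' : p' ∈ proxSet lam ψ w') :
    ‖(w - p) - (w' - p')‖ ≤ ‖w - w'‖ := by
  have h := inner_sub_prox_nonneg hψ hlam hp hp'
  have hsq := norm_add_sq_real ((w - p) - (w' - p')) (p - p')
  rw [show (w - p) - (w' - p') + (p - p') = w - w' by abel] at hsq
  exact le_of_sq_le_sq (by nlinarith [sq_nonneg ‖p - p'‖]) (norm_nonneg _)

theorem moreau_add_inner_le (hψ : ConvexOn ℝ univ ψ) (hlam : 0 < lam) {w w' p p' : X}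
    (hp : p ∈ proxSet lam ψ w) (hp' : p' ∈ proxSet lam ψ w') :
    moreau lam ψ w + inner ℝ (lam⁻¹ • (w - p)) (w' - w) ≤ moreau lam ψ w' := by
  have hsub := add_inner_le_of_mem_proxSet hψ hlam hp p'
  have hsq : 0 ≤ 1 / (2 * lam) * ‖(w' - p') - (w - p)‖ ^ 2 := by positivity
  rw [moreau_eq_of_mem_proxSet hp, moreau_eq_of_mem_proxSet hp']
  rw [show p' - p = (w' - w) - ((w' - p') - (w - p)) by abel, inner_sub_right,
    real_inner_smul_left _ ((w' - p') - (w - p)), inner_sub_right (w - p) (w' - p'),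
    real_inner_self_eq_norm_sq] at hsub
  rw [norm_sub_sq_real, real_inner_comm] at hsq
  have hexpand : 1 / (2 * lam) *
        (‖w' - p'‖ ^ 2 - 2 * inner ℝ (w - p) (w' - p') + ‖w - p‖ ^ 2)
      = 1 / (2 * lam) * ‖w' - p'‖ ^ 2 - 1 / (2 * lam) * ‖w - p‖ ^ 2
        - lam⁻¹ * (inner ℝ (w - p) (w' - p') - ‖w - p‖ ^ 2) := by
    field_simp
    ring
  linarith

theorem convexOn_univ_of_add_inner_le {E : X → ℝ} {D : X → X}
    (hsub : ∀ w y, E w + inner ℝ (D w) (y - w) ≤ E y) : ConvexOn ℝ univ E := by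
  refine ⟨convex_univ, fun x _ y _ a b ha hb hab => ?_⟩
  set w := a • x + b • y
  have hx := mul_le_mul_of_nonneg_left (hsub w x) ha
  have hy := mul_le_mul_of_nonneg_left (hsub w y) hb
  have hcancel : a * inner ℝ (D w) (x - w) + b * inner ℝ (D w) (y - w) = 0 := by
    rw [← inner_smul_right, ← inner_smul_right, ← inner_add_right,
      show a • (x - w) + b • (y - w) = w - (a + b) • w by module, hab, one_smul, sub_self,
      inner_zero_right]
  have hsum : a * E w + b * E w = E w := by rw [← add_mul, hab, one_mul]
  simp only [smul_eq_mul]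
  linarith

theorem hasGradientAt_of_add_inner_le [CompleteSpace X] {E : X → ℝ} {D : X → X} {k : ℝ}
    (hsub : ∀ w y, E w + inner ℝ (D w) (y - w) ≤ E y)
    (hlip : ∀ w y, ‖D w - D y‖ ≤ k * ‖w - y‖) (w : X) : HasGradientAt E (D w) w := by
  rw [hasGradientAt_iff_isLittleO]
  refine Asymptotics.IsBigO.trans_isLittleO (.of_bound k (Eventually.of_forall fun y => ?_))
    (Asymptotics.isLittleO_pow_sub_sub w one_lt_two)
  have hw := hsub w y
  have hy := hsub y w
  rw [← neg_sub y w, inner_neg_right] at hy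
  have hD : inner ℝ (D y - D w) (y - w) ≤ k * ‖y - w‖ * ‖y - w‖ :=
    (real_inner_le_norm _ _).trans (mul_le_mul_of_nonneg_right (hlip y w) (norm_nonneg _))
  rw [inner_sub_left] at hD
  rw [Real.norm_of_nonneg (by linarith), Real.norm_of_nonneg (by positivity)]
  nlinarith

theorem convexOn_moreau (hψ : ConvexOn ℝ univ ψ) (hlam : 0 < lam)
    (hprox : ∀ w, (proxSet lam ψ w).Nonempty) : ConvexOn ℝ univ (moreau lam ψ) := by
  choose p hp using hprox
  exact convexOn_univ_of_add_inner_le fun w y => moreau_add_inner_le hψ hlam (hp w) (hp y)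

theorem hasGradientAt_moreau [CompleteSpace X] (hψ : ConvexOn ℝ univ ψ) (hlam : 0 < lam)
    (hprox : ∀ w, (proxSet lam ψ w).Nonempty) {w p : X} (hp : p ∈ proxSet lam ψ w) :
    HasGradientAt (moreau lam ψ) (lam⁻¹ • (w - p)) w := by
  choose q hq using hprox
  rw [proxSet_subsingleton hψ hlam w hp (hq w)]
  refine hasGradientAt_of_add_inner_le (D := fun y => lam⁻¹ • (y - q y)) (k := lam⁻¹)
    (fun y y' => moreau_add_inner_le hψ hlam (hq y) (hq y')) (fun y y' => ?_) w
  rw [← smul_sub, norm_smul, norm_inv, Real.norm_of_nonneg hlam.le]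
  gcongr
  exact norm_sub_prox_le hψ hlam (hq y) (hq y')

theorem norm_fderiv_moreau_sub_le [CompleteSpace X] (hψ : ConvexOn ℝ univ ψ) (hlam : 0 < lam)
    (hprox : ∀ w, (proxSet lam ψ w).Nonempty) (w w' : X) :
    ‖fderiv ℝ (moreau lam ψ) w - fderiv ℝ (moreau lam ψ) w'‖ ≤ lam⁻¹ * ‖w - w'‖ := by
  obtain ⟨p, hp⟩ := hprox w
  obtain ⟨p', hp'⟩ := hprox w'
  rw [(hasGradientAt_moreau hψ hlam hprox hp).hasFDerivAt.fderiv,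
    (hasGradientAt_moreau hψ hlam hprox hp').hasFDerivAt.fderiv, ← map_sub,
    LinearIsometryEquiv.norm_map, ← smul_sub, norm_smul, norm_inv, Real.norm_of_nonneg hlam.le]
  gcongr
  exact norm_sub_prox_le hψ hlam hp hp'

theorem contDiff_moreau [CompleteSpace X] (hψ : ConvexOn ℝ univ ψ) (hlam : 0 < lam)
    (hprox : ∀ w, (proxSet lam ψ w).Nonempty) : ContDiff ℝ 1 (moreau lam ψ) := by
  refine contDiff_one_iff_fderiv.2 ⟨fun w => ?_, ?_⟩
  · obtain ⟨p, hp⟩ := hprox w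
    exact (hasGradientAt_moreau hψ hlam hprox hp).hasFDerivAt.differentiableAt
  · refine (LipschitzWith.of_dist_le_mul (K := lam⁻¹.toNNReal) fun w w' => ?_).continuous
    rw [dist_eq_norm, dist_eq_norm, Real.coe_toNNReal _ (inv_nonneg.2 hlam.le)]
    exact norm_fderiv_moreau_sub_le hψ hlam hprox w w'

theorem convexOn_add_mul_sq_norm_sub (hψ : ConvexOn ℝ univ ψ) {c : ℝ} (hc : 0 ≤ c) (w : X) :
    ConvexOn ℝ univ fun y => ψ y + c * ‖w - y‖ ^ 2 := by
  have hnorm : ConvexOn ℝ univ fun y => ‖w - y‖ := convexOn_univ_norm.comp_affineMap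
    (AffineMap.const ℝ X w - AffineMap.id ℝ X)
  exact hψ.add ((hnorm.pow (fun _ _ => norm_nonneg _) 2).smul hc)

theorem proxSet_nonempty [FiniteDimensional ℝ X] (hψ : ConvexOn ℝ univ ψ) (hlam : 0 < lam)
    (w : X) : (proxSet lam ψ w).Nonempty := by
  have hcont : Continuous ψ := continuousOn_univ.1 (hψ.continuousOn isOpen_univ)
  obtain ⟨l, c, hlc, -⟩ := hψ.exists_affine_le_of_lt (𝕜 := ℝ) (mem_univ w) (sub_one_lt (ψ w))
    isClosed_univ (hcont.lowerSemicontinuous.lowerSemicontinuousOn _)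
  have hlower : ∀ y, l w + c - ‖l‖ * ‖w - y‖ ≤ ψ y := fun y => by
    have hl : l (w - y) ≤ ‖l‖ * ‖w - y‖ := (le_abs_self _).trans (l.le_opNorm _)
    have hy : l y + c ≤ ψ y := hlc ⟨y, mem_univ y⟩
    rw [map_sub] at hl
    linarith
  have hnorm : Tendsto (fun y => ‖w - y‖) (cocompact X) atTop :=
    tendsto_norm_cocompact_atTop.comp (Homeomorph.subLeft w).isClosedEmbedding.tendsto_cocompact
  have hquad : Tendsto (fun r : ℝ => r * (1 / (2 * lam) * r - ‖l‖)) atTop atTop :=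
    tendsto_id.atTop_mul_atTop₀
      (tendsto_atTop_add_const_right _ _ (tendsto_id.const_mul_atTop (by positivity)))
  have hcoercive : Tendsto (fun y => ψ y + 1 / (2 * lam) * ‖w - y‖ ^ 2) (cocompact X) atTop := by
    refine tendsto_atTop_mono (fun y => ?_)
      (tendsto_atTop_add_const_left _ (l w + c) (hquad.comp hnorm))
    simp only [Function.comp_apply]
    linarith [hlower y]
  exact Continuous.exists_forall_le (by fun_prop) hcoercive

end ProximalPoint

section Minimax

variable {V X : Type*} {C : Set V} {ψ : V → X → ℝ} {S : X → ℝ}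

theorem convexOn_of_isLUB [AddCommGroup X] [Module ℝ X] (hψ : ∀ v ∈ C, ConvexOn ℝ univ (ψ v))
    (hS : ∀ y, IsLUB ((fun v => ψ v y) '' C) (S y)) : ConvexOn ℝ univ S := by
  have hle : ∀ v ∈ C, ∀ y, ψ v y ≤ S y := fun v hv y => (hS y).1 (mem_image_of_mem _ hv)
  refine ⟨convex_univ, fun x _ y _ a b ha hb hab => (hS _).2 ?_⟩
  rintro _ ⟨v, hv, rfl⟩
  refine ((hψ v hv).2 (mem_univ x) (mem_univ y) ha hb hab).trans ?_
  simp only [smul_eq_mul]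
  gcongr <;> exact hle v hv _

variable [NormedAddCommGroup X] {lam : ℝ} {w p : X}

theorem mem_proxSet_of_le_of_moreau_eq {φ : X → ℝ} (hφS : φ ≤ S)
    (hφ : (proxSet lam φ w).Nonempty) (hp : p ∈ proxSet lam S w)
    (heq : moreau lam φ w = moreau lam S w) : p ∈ proxSet lam φ w := fun y => by
  obtain ⟨p', hp'⟩ := hφ
  calc φ p + 1 / (2 * lam) * ‖w - p‖ ^ 2
      ≤ S p + 1 / (2 * lam) * ‖w - p‖ ^ 2 := by gcongr; exact hφS p
    _ = moreau lam φ w := by rw [heq, moreau_eq_of_mem_proxSet hp]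
    _ ≤ φ y + 1 / (2 * lam) * ‖w - y‖ ^ 2 := by
      rw [moreau_eq_of_mem_proxSet hp']
      exact hp' y

variable [InnerProductSpace ℝ X] [FiniteDimensional ℝ X]
  [TopologicalSpace V] [AddCommGroup V] [Module ℝ V] [IsTopologicalAddGroup V]
  [ContinuousSMul ℝ V]

theorem exists_moreau_eq_of_isLUB (hC : IsCompact C) (hCconv : Convex ℝ C) (hne : C.Nonempty)
    (husc : ∀ y, UpperSemicontinuousOn (fun v => ψ v y) C)
    (hconc : ∀ y, ConcaveOn ℝ C fun v => ψ v y) (hconv : ∀ v ∈ C, ConvexOn ℝ univ (ψ v))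
    (hS : ∀ y, IsLUB ((fun v => ψ v y) '' C) (S y)) (hlam : 0 < lam) (w : X) :
    ∃ v ∈ C, moreau lam (ψ v) w = moreau lam S w := by
  obtain ⟨p, hp⟩ := proxSet_nonempty (convexOn_of_isLUB hconv hS) hlam w
  let F : X → V → ℝ := fun y v => ψ v y + 1 / (2 * lam) * ‖w - y‖ ^ 2
  have hF : ∀ v ∈ C, ConvexOn ℝ univ fun y => F y v := fun v hv =>
    convexOn_add_mul_sq_norm_sub (hconv v hv) (by positivity) w
  obtain ⟨p₀, -, v, hv, hsaddle⟩ : ∃ p₀ ∈ Metric.closedBall p 1, ∃ v ∈ C,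
      IsSaddlePointOn (Metric.closedBall p 1) C F p₀ v :=
    Sion.exists_isSaddlePointOn ⟨p, Metric.mem_closedBall_self zero_le_one⟩
      (convex_closedBall p 1) (isCompact_closedBall p 1)
      (fun v hv => (((hF v hv).continuousOn isOpen_univ).mono
        (subset_univ _)).lowerSemicontinuousOn)
      (fun v hv => ((hF v hv).subset (subset_univ _) (convex_closedBall p 1)).quasiconvexOn)
      hCconv hne hC
      (fun y _ => (husc y).add upperSemicontinuousOn_const)
      (fun y _ => ((hconc y).add_const _).quasiconcaveOn)
  have hle : ∀ y ∈ Metric.closedBall p 1, S p + 1 / (2 * lam) * ‖w - p‖ ^ 2 ≤ F y v :=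
    fun y hy => (hp p₀).trans <| le_sub_iff_add_le.1 <| (hS p₀).2 <| by
      rintro _ ⟨u, hu, rfl⟩
      exact le_sub_iff_add_le.2 (hsaddle y hy u hu)
  have hSp : S p = ψ v p :=
    le_antisymm (le_of_add_le_add_right (hle p (Metric.mem_closedBall_self zero_le_one)))
      ((hS p).1 (mem_image_of_mem _ hv))
  have hmin : IsLocalMin (fun y => F y v) p :=
    eventually_of_mem (Metric.closedBall_mem_nhds p one_pos) fun y hy => by
      simpa only [F, hSp] using hle y hy
  have hpv : p ∈ proxSet lam (ψ v) w := IsMinOn.of_isLocalMin_of_convex_univ hmin (hF v hv)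
  exact ⟨v, hv, by rw [moreau_eq_of_mem_proxSet hp, moreau_eq_of_mem_proxSet hpv, hSp]⟩

end Minimax

section LevelGauge

variable {H Z : Type*} [NormedAddCommGroup Z] [NormedSpace ℝ Z]

/-- The gauge (Minkowski functional) of the sublevel set `{z | g (x, z) ≤ 0}`. When that set is
convex, closed and a neighbourhood of `0`, this is the reciprocal of its radial function along `u`,
and it vanishes exactly on the directions in which the set is unbounded. -/
def levelGauge (g : H × Z → ℝ) (x : H) (u : Z) : ℝ := gauge {z | g (x, z) ≤ 0} u

theorem levelGauge_nonneg (g : H × Z → ℝ) (x : H) (u : Z) : 0 ≤ levelGauge g x u := gauge_nonneg u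

theorem levelGauge_smul (g : H × Z → ℝ) (x : H) {r : ℝ} (hr : 0 ≤ r) (u : Z) :
    levelGauge g x (r • u) = r * levelGauge g x u := gauge_smul_of_nonneg hr u

variable [NormedAddCommGroup H]

/-- A uniform Slater condition on the open set `U` for the constraints `g (x, ·) ≤ 0`: each is
convex, has slack `δ` at the origin and holds on the ball of radius `ε`, and `g` is Lipschitz in
`x`, with a constant that may grow linearly in `z`. -/
structure SlaterOn (g : H × Z → ℝ) (U : Set H) (ε δ M : ℝ) : Prop where
  isOpen : IsOpen U
  radius_pos : 0 < ε
  slack_pos : 0 < δ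
  bound_nonneg : 0 ≤ M
  convexOn : ∀ x ∈ U, ConvexOn ℝ univ fun z => g (x, z)
  continuous : ∀ x ∈ U, Continuous fun z => g (x, z)
  nonpos : ∀ x ∈ U, ∀ z, ‖z‖ < ε → g (x, z) ≤ 0
  slack : ∀ x ∈ U, g (x, 0) ≤ -δ
  lipschitz : ∀ x ∈ U, ∀ y ∈ U, ∀ z, g (y, z) ≤ g (x, z) + M * (1 + ‖z‖) * ‖y - x‖

theorem exists_slaterOn [NormedSpace ℝ H] {g : H × Z → ℝ} {xbar : H} {M : ℝ}
    (hg : Differentiable ℝ g) (hconv : ∀ x, ConvexOn ℝ univ fun z => g (x, z))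
    (hgrowth : ∀ᶠ x in 𝓝 xbar, ∀ z, ‖fderiv ℝ g (x, z)‖ ≤ M * (1 + ‖z‖))
    (hneg : g (xbar, 0) < 0) :
    ∃ ε δ : ℝ, SlaterOn g (Metric.ball xbar ε) ε δ M := by
  obtain ⟨δ, hδ, hneg'⟩ : ∃ δ > 0, g (xbar, 0) < -δ :=
    ⟨-g (xbar, 0) / 2, by linarith, by linarith⟩
  have hnear : ∀ᶠ q in 𝓝 (xbar, (0 : Z)), g q < -δ :=
    hg.continuous.continuousAt.eventually_lt continuousAt_const hneg'
  obtain ⟨ε, hε, hball⟩ := Metric.eventually_nhds_iff_ball.1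
    (hnear.and (continuous_fst.tendsto (xbar, (0 : Z)) |>.eventually hgrowth))
  have hmem : ∀ x ∈ Metric.ball xbar ε, ∀ z : Z, ‖z‖ < ε → (x, z) ∈ Metric.ball (xbar, 0) ε :=
    fun x hx z hz => by
      rw [← ball_prod_same]
      exact ⟨hx, mem_ball_zero_iff.2 hz⟩
  have hslack : ∀ x ∈ Metric.ball xbar ε, ∀ z : Z, ‖z‖ < ε → g (x, z) < -δ :=
    fun x hx z hz => (hball _ (hmem x hx z hz)).1
  have hbound : ∀ x ∈ Metric.ball xbar ε, ∀ z, ‖fderiv ℝ g (x, z)‖ ≤ M * (1 + ‖z‖) :=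
    fun x hx => (hball _ (hmem x hx 0 (by rwa [norm_zero]))).2
  refine ⟨ε, δ, Metric.isOpen_ball, hε, hδ, ?_, fun x _ => hconv x,
    fun x _ => hg.continuous.comp (Continuous.prodMk_right x),
    fun x hx z hz => ((hslack x hx z hz).trans (neg_lt_zero.2 hδ)).le,
    fun x hx => (hslack x hx 0 (by rwa [norm_zero])).le, fun x hx y hy z => ?_⟩
  · simpa using (norm_nonneg _).trans (hbound xbar (Metric.mem_ball_self hε) 0)
  · have hderiv : ∀ x' ∈ Metric.ball xbar ε, HasFDerivWithinAt (fun x' => g (x', z))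
        ((fderiv ℝ g (x', z)).comp (.inl ℝ H Z)) (Metric.ball xbar ε) x' := fun x' _ =>
      ((hg (x', z)).hasFDerivAt.comp x' (hasFDerivAt_prodMk_left x' z)).hasFDerivWithinAt
    have hle := (convex_ball xbar ε).norm_image_sub_le_of_norm_hasFDerivWithin_le hderiv
      (C := M * (1 + ‖z‖)) (fun x' hx' => (ContinuousLinearMap.opNorm_comp_le _ _).trans <|
        (mul_le_of_le_one_right (norm_nonneg _) (ContinuousLinearMap.norm_inl_le_one _ _ _)).trans
          (hbound x' hx' z)) hx hy
    linarith [(le_abs_self _).trans hle]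

namespace SlaterOn

variable {g : H × Z → ℝ} {U : Set H} {ε δ M : ℝ} {x y : H}

theorem convex_sublevel (hg : SlaterOn g U ε δ M) (hx : x ∈ U) :
    Convex ℝ {z | g (x, z) ≤ 0} := by
  simpa using (hg.convexOn x hx).convex_le 0

theorem sublevel_mem_nhds (hg : SlaterOn g U ε δ M) (hx : x ∈ U) :
    {z | g (x, z) ≤ 0} ∈ 𝓝 (0 : Z) :=
  mem_of_superset (Metric.ball_mem_nhds 0 hg.radius_pos) fun z hz =>
    hg.nonpos x hx z (mem_ball_zero_iff.1 hz)

theorem levelGauge_le_one_iff (hg : SlaterOn g U ε δ M) (hx : x ∈ U) {z : Z} :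
    levelGauge g x z ≤ 1 ↔ g (x, z) ≤ 0 := by
  rw [levelGauge, gauge_le_one_iff_mem_closure (hg.convex_sublevel hx) (hg.sublevel_mem_nhds hx),
    (isClosed_le (hg.continuous x hx) continuous_const).closure_eq]
  rfl

theorem neg_of_levelGauge_lt_one (hg : SlaterOn g U ε δ M) (hx : x ∈ U) {z : Z}
    (hz : levelGauge g x z < 1) : g (x, z) < 0 := by
  obtain ⟨b, hb0, hb1, y, hy, rfl⟩ := exists_lt_of_gauge_lt
    (absorbent_nhds_zero (hg.sublevel_mem_nhds hx)) hz
  have hconv := (hg.convexOn x hx).2 (mem_univ y) (mem_univ 0) hb0.le (sub_nonneg.2 hb1.le)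
    (by ring)
  simp only [smul_zero, add_zero, smul_eq_mul] at hconv
  have hy0 : b * g (x, y) ≤ 0 := mul_nonpos_of_nonneg_of_nonpos hb0.le hy
  have hslack : (1 - b) * g (x, 0) < 0 :=
    mul_neg_of_pos_of_neg (sub_pos.2 hb1) ((hg.slack x hx).trans_lt (neg_lt_zero.2 hg.slack_pos))
  exact hconv.trans_lt (by linarith)

theorem levelGauge_eq_one_iff (hg : SlaterOn g U ε δ M) (hx : x ∈ U) {z : Z} :
    levelGauge g x z = 1 ↔ g (x, z) = 0 := by
  have hle := hg.levelGauge_le_one_iff hx (z := z)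
  refine ⟨fun h => (hle.1 h.le).eq_of_not_lt fun hlt => ?_,
    fun h => (hle.2 h.le).eq_of_not_lt fun hlt => (hg.neg_of_levelGauge_lt_one hx hlt).ne h⟩
  have hint : z ∈ interior {z | g (x, z) ≤ 0} :=
    interior_maximal (fun y (hy : g (x, y) < 0) => hy.le)
      (isOpen_lt (hg.continuous x hx) continuous_const) hlt
  exact ((gauge_lt_one_iff_mem_interior (hg.convex_sublevel hx)
    (hg.sublevel_mem_nhds hx)).2 hint).ne h

theorem levelGauge_le (hg : SlaterOn g U ε δ M) (hx : x ∈ U) (u : Z) :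
    levelGauge g x u ≤ ε⁻¹ * ‖u‖ := by
  rw [← div_eq_inv_mul, le_div_iff₀' hg.radius_pos]
  exact mul_gauge_le_norm fun z hz => hg.nonpos x hx z (mem_ball_zero_iff.1 hz)

theorem levelGauge_le_add_of_lt (hg : SlaterOn g U ε δ M) (hx : x ∈ U) (hy : y ∈ U) {u : Z}
    {s : ℝ} (hs : levelGauge g x u < s) :
    levelGauge g y u ≤ s + M * (s + ‖u‖) / δ * ‖y - x‖ := by
  have hδ := hg.slack_pos
  have hM := hg.bound_nonneg
  have hs0 : 0 < s := (levelGauge_nonneg g x u).trans_lt hs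
  set a := M * (1 + ‖s⁻¹ • u‖) * ‖y - x‖ with ha
  have ha0 : 0 ≤ a := by positivity
  have hx0 : g (x, s⁻¹ • u) ≤ 0 := by
    rw [← hg.levelGauge_le_one_iff hx, levelGauge_smul _ _ (by positivity), inv_mul_le_one₀ hs0]
    exact hs.le
  have hya : g (y, s⁻¹ • u) ≤ a := by linarith [hg.lipschitz x hx y hy (s⁻¹ • u)]
  -- The slack at the origin pays for `a` after contracting towards it by `δ / (δ + a)`.
  have hy0 : g (y, (δ / (δ + a)) • s⁻¹ • u) ≤ 0 := by
    have hconv := (hg.convexOn y hy).2 (mem_univ (s⁻¹ • u)) (mem_univ 0)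
      (by positivity : 0 ≤ δ / (δ + a)) (by positivity : 0 ≤ a / (δ + a)) (by field_simp)
    simp only [smul_zero, add_zero, smul_eq_mul] at hconv
    calc g (y, (δ / (δ + a)) • s⁻¹ • u)
        ≤ δ / (δ + a) * g (y, s⁻¹ • u) + a / (δ + a) * g (y, 0) := hconv
      _ ≤ δ / (δ + a) * a + a / (δ + a) * (-δ) := by
          gcongr
          exact hg.slack y hy
      _ = 0 := by ring
  rw [← hg.levelGauge_le_one_iff hy, smul_smul, levelGauge_smul _ _ (by positivity),
    show δ / (δ + a) * s⁻¹ = (s * (1 + a / δ))⁻¹ by field_simp,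
    inv_mul_le_one₀ (by positivity)] at hy0
  refine hy0.trans_eq ?_
  rw [ha, norm_smul, norm_inv, Real.norm_of_nonneg hs0.le]
  field_simp

theorem levelGauge_le_add (hg : SlaterOn g U ε δ M) (hx : x ∈ U) (hy : y ∈ U) (u : Z) :
    levelGauge g y u ≤ levelGauge g x u + M * (ε⁻¹ + 1) / δ * ‖u‖ * ‖y - x‖ := by
  have hδ := hg.slack_pos
  have hM := hg.bound_nonneg
  have hlim : Tendsto (fun s => s + M * (s + ‖u‖) / δ * ‖y - x‖) (𝓝[>] levelGauge g x u)
      (𝓝 (levelGauge g x u + M * (levelGauge g x u + ‖u‖) / δ * ‖y - x‖)) :=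
    (Continuous.tendsto (by fun_prop) _).mono_left nhdsWithin_le_nhds
  refine (ge_of_tendsto hlim (eventually_of_mem self_mem_nhdsWithin fun s hs =>
    hg.levelGauge_le_add_of_lt hx hy hs)).trans ?_
  have hcoef : M * (levelGauge g x u + ‖u‖) / δ ≤ M * (ε⁻¹ + 1) / δ * ‖u‖ :=
    calc M * (levelGauge g x u + ‖u‖) / δ ≤ M * (ε⁻¹ * ‖u‖ + ‖u‖) / δ := by
          gcongr
          exact hg.levelGauge_le hx u
      _ = M * (ε⁻¹ + 1) / δ * ‖u‖ := by ring
  gcongr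

theorem abs_levelGauge_sub_le (hg : SlaterOn g U ε δ M) {R : ℝ} {u : Z} (hu : ‖u‖ ≤ R)
    (hx : x ∈ U) (hy : y ∈ U) :
    |levelGauge g y u - levelGauge g x u| ≤ M * (ε⁻¹ + 1) / δ * R * ‖y - x‖ := by
  have hδ := hg.slack_pos
  have hε := hg.radius_pos
  have hM := hg.bound_nonneg
  have hxy := hg.levelGauge_le_add hx hy u
  have hyx := hg.levelGauge_le_add hy hx u
  rw [norm_sub_rev x y] at hyx
  have hmono : M * (ε⁻¹ + 1) / δ * ‖u‖ * ‖y - x‖ ≤ M * (ε⁻¹ + 1) / δ * R * ‖y - x‖ := by gcongr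
  exact abs_sub_le_iff.2 ⟨by linarith, by linarith⟩

theorem continuousOn_levelGauge (hg : SlaterOn g U ε δ M) {T : Type*} [TopologicalSpace T]
    {u : T → Z} (hu : Continuous u) {R : ℝ} (hR : ∀ v, ‖u v‖ ≤ R) :
    ContinuousOn (fun q : H × T => levelGauge g q.1 (u q.2)) (U ×ˢ univ) := by
  refine continuousOn_prod_of_continuousOn_lipschitzOnWith _
    (Real.toNNReal (M * (ε⁻¹ + 1) / δ * R)) (fun x hx => ?_) fun v _ => ?_
  · exact ((continuous_gauge (hg.convex_sublevel hx)
      (hg.sublevel_mem_nhds hx)).comp hu).continuousOn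
  · refine LipschitzOnWith.of_dist_le_mul fun x hx y hy => ?_
    rw [Real.dist_eq, dist_eq_norm]
    refine (hg.abs_levelGauge_sub_le (hR v) hy hx).trans ?_
    gcongr
    exact Real.le_coe_toNNReal _

theorem eq_zero_of_levelGauge_pos (hg : SlaterOn g U ε δ M) (hx : x ∈ U) {u : Z}
    (hpos : 0 < levelGauge g x u) : g (x, (levelGauge g x u)⁻¹ • u) = 0 := by
  rw [← hg.levelGauge_eq_one_iff hx, levelGauge_smul _ _ (inv_nonneg.2 hpos.le),
    inv_mul_cancel₀ hpos.ne']

end SlaterOn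

end LevelGauge

section LevelGaugeDeriv

theorem sub_le_apply_sub_of_hasFDerivAt {Z : Type*} [NormedAddCommGroup Z] [NormedSpace ℝ Z]
    {φ : Z → ℝ} {φ' : Z →L[ℝ] ℝ} {z : Z} (hφ : ConvexOn ℝ univ φ) (hφ' : HasFDerivAt φ φ' z)
    (y : Z) : φ z - φ y ≤ φ' (z - y) := by
  have hline : HasDerivAt (φ ∘ AffineMap.lineMap y z) (φ' (z - y)) (1 : ℝ) :=
    HasFDerivAt.comp_hasDerivAt_of_eq 1 hφ' AffineMap.hasDerivAt_lineMap
      (AffineMap.lineMap_apply_one y z).symm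
  have hslope := (hφ.comp_affineMap (AffineMap.lineMap y z)).slope_le_of_hasDerivAt
    (mem_univ 0) (mem_univ 1) one_pos hline
  simpa [slope_def_field] using hslope

variable {H : Type*} [NormedAddCommGroup H] [NormedSpace ℝ H]

theorem hasFDerivAt_of_implicit {F : H × ℝ → ℝ} {F' : H × ℝ →L[ℝ] ℝ} {σ : H → ℝ} {x₀ : H} {k : ℝ}
    (hF : HasFDerivAt F F' (x₀, σ x₀)) (hzero : ∀ᶠ x in 𝓝 x₀, F (x, σ x) = 0)
    (hlip : ∀ᶠ x in 𝓝 x₀, |σ x - σ x₀| ≤ k * ‖x - x₀‖) (hF' : F' (0, 1) ≠ 0) :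
    HasFDerivAt σ (-(F' (0, 1))⁻¹ • F'.comp (.inl ℝ H ℝ)) x₀ := by
  have hσ : (fun x => σ x - σ x₀) =O[𝓝 x₀] fun x => x - x₀ := .of_bound k (by simpa using hlip)
  have hgraph : (fun x => (x, σ x) - (x₀, σ x₀)) =O[𝓝 x₀] fun x => x - x₀ :=
    (Asymptotics.isBigO_refl _ _).prod_left hσ
  have htendsto : Tendsto (fun x => (x, σ x)) (𝓝 x₀) (𝓝 (x₀, σ x₀)) :=
    continuousAt_id.prodMk_nhds <| tendsto_sub_nhds_zero_iff.1 <|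
      hσ.trans_tendsto (tendsto_sub_nhds_zero_iff.2 tendsto_id)
  have hlittle := (hF.isLittleO.comp_tendsto htendsto).trans_isBigO hgraph
  refine .of_isLittleO ((hlittle.const_mul_left (-(F' (0, 1))⁻¹)).congr' ?_ .rfl)
  filter_upwards [hzero] with x hx
  have hsplit : F' ((x, σ x) - (x₀, σ x₀)) = F' (x - x₀, 0) + (σ x - σ x₀) * F' (0, 1) := by
    rw [← smul_eq_mul, ← map_smul, ← map_add]
    simp
  simp only [Function.comp_apply, hx, hzero.self_of_nhds, hsplit]
  simp
  field_simp
  ring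

variable {Z : Type*} [NormedAddCommGroup Z] [NormedSpace ℝ Z]

/-- The derivative of `x ↦ levelGauge g x u` obtained by implicit differentiation of
`g (x, s⁻¹ • u) = 0` at `s = levelGauge g x u`. It is `0` where the gauge vanishes. -/
def levelGaugeDeriv (g : H × Z → ℝ) (x : H) (u : Z) : H →L[ℝ] ℝ :=
  (levelGauge g x u ^ 2 / fderiv ℝ g (x, (levelGauge g x u)⁻¹ • u) (0, u)) •
    (fderiv ℝ g (x, (levelGauge g x u)⁻¹ • u)).comp (.inl ℝ H Z)

theorem levelGaugeDeriv_of_levelGauge_eq_zero {g : H × Z → ℝ} {x : H} {u : Z}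
    (h : levelGauge g x u = 0) : levelGaugeDeriv g x u = 0 := by
  simp [levelGaugeDeriv, h]

namespace SlaterOn

variable {g : H × Z → ℝ} {U : Set H} {ε δ M : ℝ} {x : H} {u : Z}

theorem fderiv_apply_pos (hg : SlaterOn g U ε δ M) (hx : x ∈ U)
    (hpos : 0 < levelGauge g x u)
    (hdiff : DifferentiableAt ℝ g (x, (levelGauge g x u)⁻¹ • u)) :
    0 < fderiv ℝ g (x, (levelGauge g x u)⁻¹ • u) (0, u) := by
  have hpartial := hdiff.hasFDerivAt.comp _
    (hasFDerivAt_prodMk_right x ((levelGauge g x u)⁻¹ • u))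
  have hle := sub_le_apply_sub_of_hasFDerivAt (hg.convexOn x hx) hpartial 0
  rw [hg.eq_zero_of_levelGauge_pos hx hpos, sub_zero, map_smul, smul_eq_mul] at hle
  have hslack := hg.slack x hx
  have hδ := hg.slack_pos
  exact pos_of_mul_pos_right (hle.trans_lt' (by linarith)) (inv_nonneg.2 hpos.le)

theorem hasFDerivAt_levelGauge (hg : SlaterOn g U ε δ M) (hdiff : Differentiable ℝ g) (hx : x ∈ U)
    (hpos : 0 < levelGauge g x u) :
    HasFDerivAt (fun y => levelGauge g y u) (levelGaugeDeriv g x u) x := by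
  have hU := hg.isOpen.mem_nhds hx
  have hlip : ∀ᶠ y in 𝓝 x, |levelGauge g y u - levelGauge g x u|
      ≤ M * (ε⁻¹ + 1) / δ * ‖u‖ * ‖y - x‖ := by
    filter_upwards [hU] with y hy using hg.abs_levelGauge_sub_le le_rfl hx hy
  have hcont : ContinuousAt (fun y => levelGauge g y u) x :=
    ((hg.continuousOn_levelGauge (u := fun _ : Unit => u) continuous_const fun _ => le_rfl).comp
      (f := fun y : H => (y, ())) (by fun_prop) fun y hy => ⟨hy, mem_univ _⟩).continuousAt hU
  have hzero : ∀ᶠ y in 𝓝 x, g (y, (levelGauge g y u)⁻¹ • u) = 0 := by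
    filter_upwards [hU, hcont.eventually (lt_mem_nhds hpos)] with y hy hy0
    exact hg.eq_zero_of_levelGauge_pos hy hy0
  set s := levelGauge g x u with hs
  have hcurve : HasFDerivAt (fun q : H × ℝ => (q.1, q.2⁻¹ • u))
      ((ContinuousLinearMap.fst ℝ H ℝ).prod
        ((-(s ^ 2)⁻¹ • ContinuousLinearMap.snd ℝ H ℝ).smulRight u)) (x, s) :=
    hasFDerivAt_fst.prodMk
      (((hasDerivAt_inv hpos.ne').comp_hasFDerivAt (x, s) hasFDerivAt_snd).smul_const u)
  have hF : HasFDerivAt (fun q : H × ℝ => g (q.1, q.2⁻¹ • u)) _ (x, s) :=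
    (hdiff (x, s⁻¹ • u)).hasFDerivAt.comp (x, s) hcurve
  have hslope := hg.fderiv_apply_pos hx hpos (hdiff _)
  rw [← hs] at hslope
  have hF's : (fderiv ℝ g (x, s⁻¹ • u)) (0, -((s ^ 2)⁻¹ • u))
      = -((s ^ 2)⁻¹ * fderiv ℝ g (x, s⁻¹ • u) (0, u)) := by
    rw [← neg_mul, ← smul_eq_mul, ← map_smul, Prod.smul_mk, smul_zero, neg_smul]
  have himp := hasFDerivAt_of_implicit hF hzero hlip (by
    simp [hF's, hpos.ne', hslope.ne'])
  refine himp.congr_fderiv (ContinuousLinearMap.ext fun a => ?_)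
  simp [levelGaugeDeriv, hF's, ← hs, div_eq_mul_inv, mul_comm]

theorem norm_levelGaugeDeriv_le (hg : SlaterOn g U ε δ M) (hdiff : Differentiable ℝ g)
    (hx : x ∈ U) {R : ℝ} (hu : ‖u‖ ≤ R) :
    ‖levelGaugeDeriv g x u‖ ≤ M * (ε⁻¹ + 1) / δ * R := by
  have hbound : 0 ≤ M * (ε⁻¹ + 1) / δ * R :=
    mul_nonneg (div_nonneg (mul_nonneg hg.bound_nonneg (by linarith [inv_pos.2 hg.radius_pos]))
      hg.slack_pos.le) ((norm_nonneg u).trans hu)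
  rcases (levelGauge_nonneg g x u).eq_or_lt with h0 | hpos
  · rwa [levelGaugeDeriv_of_levelGauge_eq_zero h0.symm, norm_zero]
  · refine (hg.hasFDerivAt_levelGauge hdiff hx hpos).le_of_lip' hbound ?_
    filter_upwards [hg.isOpen.mem_nhds hx] with y hy using hg.abs_levelGauge_sub_le hu hx hy

theorem continuousAt_levelGaugeDeriv (hg : SlaterOn g U ε δ M) (hcd : ContDiff ℝ 1 g) (hx : x ∈ U)
    {T : Type*} [TopologicalSpace T] {u : T → Z} (hu : Continuous u) {R : ℝ}
    (hR : ∀ v, ‖u v‖ ≤ R) {v : T} (hpos : 0 < levelGauge g x (u v)) :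
    ContinuousAt (fun q : H × T => levelGaugeDeriv g q.1 (u q.2)) (x, v) := by
  have hgauge : ContinuousAt (fun q : H × T => levelGauge g q.1 (u q.2)) (x, v) :=
    (hg.continuousOn_levelGauge hu hR).continuousAt
      ((hg.isOpen.prod isOpen_univ).mem_nhds ⟨hx, mem_univ v⟩)
  have hslope := hg.fderiv_apply_pos hx hpos (hcd.differentiable one_ne_zero _)
  have hfderiv : ContinuousAt (fun q : H × T =>
      fderiv ℝ g (q.1, (levelGauge g q.1 (u q.2))⁻¹ • u q.2)) (x, v) :=
    (hcd.continuous_fderiv one_ne_zero).continuousAt.comp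
      (continuousAt_fst.prodMk ((hgauge.inv₀ hpos.ne').smul
        (hu.comp continuous_snd).continuousAt))
  exact ((hgauge.pow 2).div (hfderiv.clm_apply
    (continuousAt_const.prodMk (hu.comp continuous_snd).continuousAt)) hslope.ne').smul
      (hfderiv.clm_comp continuousAt_const)

end SlaterOn

end LevelGaugeDeriv

section TailMass

variable {H Z T : Type*} [NormedAddCommGroup H] [NormedAddCommGroup Z] [NormedSpace ℝ Z]

/-- The mass of `q v` on `[0, levelGauge g x (u v)]`. When `q v t` is a density in the reciprocal
radial variable `t = 1 / r`, this is the mass of the ray of direction `u v` outside the sublevel set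
`{z | g (x, z) ≤ 0}`. -/
def tailMass (q : T → ℝ → ℝ) (g : H × Z → ℝ) (u : T → Z) (x : H) (v : T) : ℝ :=
  ∫ t in 0..levelGauge g x (u v), q v t

namespace SlaterOn

variable [TopologicalSpace T] {g : H × Z → ℝ} {U : Set H} {ε δ M : ℝ}
  {u : T → Z} {q : T → ℝ → ℝ} {x : H}

theorem continuous_tailMass (hg : SlaterOn g U ε δ M) (hu : Continuous u)
    (hq : Continuous fun p : T × ℝ => q p.1 p.2) (hx : x ∈ U) : Continuous (tailMass q g u x) :=
  intervalIntegral.continuous_parametric_intervalIntegral_of_continuous hq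
    ((continuous_gauge (hg.convex_sublevel hx) (hg.sublevel_mem_nhds hx)).comp hu)

theorem exists_lipschitz_tailMass [CompactSpace T] (hg : SlaterOn g U ε δ M) (hu : Continuous u)
    (hq : Continuous fun p : T × ℝ => q p.1 p.2) :
    ∃ K : ℝ, 0 ≤ K ∧ ∀ v, ∀ x ∈ U, ∀ y ∈ U,
      ‖tailMass q g u y v - tailMass q g u x v‖ ≤ K * ‖y - x‖ := by
  obtain ⟨R, hR⟩ := (isCompact_univ (X := T)).exists_bound_of_continuousOn hu.continuousOn
  obtain ⟨Q, hQ⟩ := ((isCompact_univ (X := T)).prod (isCompact_Icc (a := 0) (b := ε⁻¹ * R))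
    ).exists_bound_of_continuousOn hq.continuousOn
  refine ⟨|Q| * |M * (ε⁻¹ + 1) / δ * R|, by positivity, fun v x hx y hy => ?_⟩
  have hmem : ∀ z ∈ U, levelGauge g z (u v) ∈ Icc 0 (ε⁻¹ * R) := fun z hz =>
    ⟨levelGauge_nonneg _ _ _, (hg.levelGauge_le hz _).trans
      (mul_le_mul_of_nonneg_left (hR v (mem_univ v)) (inv_nonneg.2 hg.radius_pos.le))⟩
  have hqv : Continuous (q v) := hq.comp (by fun_prop : Continuous fun t => (v, t))
  rw [tailMass, tailMass, intervalIntegral.integral_interval_sub_left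
    (hqv.intervalIntegrable _ _) (hqv.intervalIntegrable _ _)]
  calc ‖∫ t in levelGauge g x (u v)..levelGauge g y (u v), q v t‖
      ≤ |Q| * |levelGauge g y (u v) - levelGauge g x (u v)| :=
        intervalIntegral.norm_integral_le_of_norm_le_const fun t ht =>
          (hQ (v, t) ⟨mem_univ v, uIcc_subset_Icc (hmem x hx) (hmem y hy)
            (uIoc_subset_uIcc ht)⟩).trans (le_abs_self Q)
    _ ≤ |Q| * (|M * (ε⁻¹ + 1) / δ * R| * ‖y - x‖) := by
        gcongr
        exact (hg.abs_levelGauge_sub_le (hR v (mem_univ v)) hx hy).trans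
          (mul_le_mul_of_nonneg_right (le_abs_self _) (norm_nonneg _))
    _ = _ := by ring

end SlaterOn

variable [NormedSpace ℝ H]

/-- The derivative of `x ↦ tailMass q g u x v`. -/
def tailMassDeriv (q : T → ℝ → ℝ) (g : H × Z → ℝ) (u : T → Z) (x : H) (v : T) : H →L[ℝ] ℝ :=
  q v (levelGauge g x (u v)) • levelGaugeDeriv g x (u v)

theorem tailMassDeriv_of_levelGauge_eq_zero {q : T → ℝ → ℝ} {g : H × Z → ℝ} {u : T → Z} {x : H}
    {v : T} (h : levelGauge g x (u v) = 0) : tailMassDeriv q g u x v = 0 := by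
  rw [tailMassDeriv, levelGaugeDeriv_of_levelGauge_eq_zero h, smul_zero]

theorem hasFDerivAt_comp_of_hasDerivAt_zero {F : ℝ → ℝ} {σ : H → ℝ} {x : H} {k : ℝ}
    (hF : HasDerivAt F 0 (σ x)) (hσ : ∀ᶠ y in 𝓝 x, |σ y - σ x| ≤ k * ‖y - x‖) :
    HasFDerivAt (fun y => F (σ y)) (0 : H →L[ℝ] ℝ) x := by
  have hO : (fun y => σ y - σ x) =O[𝓝 x] fun y => y - x := .of_bound k (by simpa using hσ)
  have hcont : Tendsto σ (𝓝 x) (𝓝 (σ x)) := tendsto_sub_nhds_zero_iff.1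
    (hO.trans_tendsto (tendsto_sub_nhds_zero_iff.2 tendsto_id))
  refine .of_isLittleO (((hF.hasFDerivAt.isLittleO.comp_tendsto hcont).trans_isBigO hO).congr_left
    fun y => ?_)
  simp

namespace SlaterOn

variable {g : H × Z → ℝ} {U : Set H} {ε δ M : ℝ}
  {u : T → Z} {q : T → ℝ → ℝ} {x : H}

theorem hasFDerivAt_tailMass (hg : SlaterOn g U ε δ M) (hdiff : Differentiable ℝ g) {v : T}
    (hqv : Continuous (q v)) (hq0 : q v 0 = 0) (hx : x ∈ U) :
    HasFDerivAt (fun y => tailMass q g u y v) (tailMassDeriv q g u x v) x := by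
  have hprim : HasDerivAt (fun s => ∫ t in 0..s, q v t) (q v (levelGauge g x (u v)))
      (levelGauge g x (u v)) :=
    intervalIntegral.integral_hasDerivAt_right (hqv.intervalIntegrable _ _)
      (hqv.stronglyMeasurableAtFilter _ _) hqv.continuousAt
  rcases (levelGauge_nonneg g x (u v)).eq_or_lt with hzero | hpos
  · rw [tailMassDeriv_of_levelGauge_eq_zero hzero.symm]
    rw [show q v (levelGauge g x (u v)) = 0 by rw [← hzero, hq0]] at hprim
    have hlip : ∀ᶠ y in 𝓝 x, |levelGauge g y (u v) - levelGauge g x (u v)|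
        ≤ M * (ε⁻¹ + 1) / δ * ‖u v‖ * ‖y - x‖ := by
      filter_upwards [hg.isOpen.mem_nhds hx] with y hy using hg.abs_levelGauge_sub_le le_rfl hx hy
    exact hasFDerivAt_comp_of_hasDerivAt_zero (σ := fun y => levelGauge g y (u v)) hprim hlip
  · exact hprim.comp_hasFDerivAt x (hg.hasFDerivAt_levelGauge hdiff hx hpos)

variable [TopologicalSpace T] [CompactSpace T]

theorem continuousOn_tailMassDeriv (hg : SlaterOn g U ε δ M) (hcd : ContDiff ℝ 1 g)
    (hu : Continuous u) (hq : Continuous fun p : T × ℝ => q p.1 p.2) (hq0 : ∀ v, q v 0 = 0) :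
    ContinuousOn (fun p : H × T => tailMassDeriv q g u p.1 p.2) (U ×ˢ univ) := by
  obtain ⟨R, hR⟩ := (isCompact_univ (X := T)).exists_bound_of_continuousOn hu.continuousOn
  replace hR := fun v => hR v (mem_univ v)
  rintro ⟨x, v⟩ hxv
  have hnhds := (hg.isOpen.prod isOpen_univ).mem_nhds hxv
  refine ContinuousAt.continuousWithinAt ?_
  have hcoef : ContinuousAt (fun p : H × T => q p.2 (levelGauge g p.1 (u p.2))) (x, v) :=
    hq.continuousAt.comp (f := fun p : H × T => (p.2, levelGauge g p.1 (u p.2)))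
      (continuousAt_snd.prodMk ((hg.continuousOn_levelGauge hu hR).continuousAt hnhds))
  rcases (levelGauge_nonneg g x (u v)).eq_or_lt with hzero | hpos
  · rw [ContinuousAt, tailMassDeriv_of_levelGauge_eq_zero hzero.symm]
    refine squeeze_zero_norm' (a := fun p : H × T => ‖q p.2 (levelGauge g p.1 (u p.2))‖ *
      (M * (ε⁻¹ + 1) / δ * R)) ?_ ?_
    · filter_upwards [hnhds] with p hp
      rw [tailMassDeriv, norm_smul]
      gcongr
      exact hg.norm_levelGaugeDeriv_le (hcd.differentiable one_ne_zero) hp.1 (hR p.2)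
    · simpa [← hzero, hq0] using hcoef.norm.tendsto.mul_const (M * (ε⁻¹ + 1) / δ * R)
  · exact hcoef.smul (hg.continuousAt_levelGaugeDeriv hcd hxv.1 hu hR hpos)

theorem continuous_tailMassDeriv (hg : SlaterOn g U ε δ M) (hcd : ContDiff ℝ 1 g)
    (hu : Continuous u) (hq : Continuous fun p : T × ℝ => q p.1 p.2) (hq0 : ∀ v, q v 0 = 0)
    (hx : x ∈ U) : Continuous (tailMassDeriv q g u x) :=
  (hg.continuousOn_tailMassDeriv hcd hu hq hq0).comp_continuous (f := fun v => (x, v))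
    (by fun_prop) fun v => ⟨hx, mem_univ v⟩

variable [MeasurableSpace T] [OpensMeasurableSpace T] {μ : Measure T} [IsFiniteMeasure μ]

theorem integrable_tailMassDeriv (hg : SlaterOn g U ε δ M) (hcd : ContDiff ℝ 1 g)
    (hu : Continuous u) (hq : Continuous fun p : T × ℝ => q p.1 p.2) (hq0 : ∀ v, q v 0 = 0)
    (hx : x ∈ U) : Integrable (tailMassDeriv q g u x) μ :=
  (hg.continuous_tailMassDeriv hcd hu hq hq0 hx).integrable_of_hasCompactSupport
    (.of_compactSpace _)

theorem hasFDerivAt_integral_tailMass (hg : SlaterOn g U ε δ M) (hcd : ContDiff ℝ 1 g)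
    (hu : Continuous u) (hq : Continuous fun p : T × ℝ => q p.1 p.2) (hq0 : ∀ v, q v 0 = 0)
    (hx : x ∈ U) :
    HasFDerivAt (fun y => ∫ v, tailMass q g u y v ∂μ) (∫ v, tailMassDeriv q g u x v ∂μ) x := by
  obtain ⟨K, hK0, hK⟩ := hg.exists_lipschitz_tailMass hu hq
  have hmeas : ∀ y ∈ U, AEStronglyMeasurable (tailMass q g u y) μ := fun y hy =>
    ((hg.continuous_tailMass hu hq hy).integrable_of_hasCompactSupport
      (.of_compactSpace _)).aestronglyMeasurable
  exact (hasFDerivAt_integral_of_dominated_loc_of_lip (bound := fun _ => K)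
    (hg.isOpen.mem_nhds hx) (eventually_of_mem (hg.isOpen.mem_nhds hx) hmeas)
    ((hg.continuous_tailMass hu hq hx).integrable_of_hasCompactSupport (.of_compactSpace _))
    (hg.integrable_tailMassDeriv hcd hu hq hq0 hx).aestronglyMeasurable
    (ae_of_all _ fun v => LipschitzOnWith.of_dist_le_mul fun y hy z hz => by
      rw [dist_eq_norm, dist_eq_norm, Real.coe_nnabs, abs_of_nonneg hK0]
      exact hK v z hz y hy)
    (integrable_const K)
    (ae_of_all _ fun v => hg.hasFDerivAt_tailMass (hcd.differentiable one_ne_zero)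
      (hq.comp (by fun_prop : Continuous fun t => (v, t))) (hq0 v) hx)).2

theorem continuousOn_integral_tailMassDeriv (hg : SlaterOn g U ε δ M) (hcd : ContDiff ℝ 1 g)
    (hu : Continuous u) (hq : Continuous fun p : T × ℝ => q p.1 p.2) (hq0 : ∀ v, q v 0 = 0) :
    ContinuousOn (fun x => ∫ v, tailMassDeriv q g u x v ∂μ) U := by
  obtain ⟨K, hK0, hK⟩ := hg.exists_lipschitz_tailMass hu hq
  intro x hx
  have hU := hg.isOpen.mem_nhds hx
  refine (continuousAt_of_dominated (bound := fun _ => K) ?_ ?_ (integrable_const K)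
    (ae_of_all _ fun v => ?_)).continuousWithinAt
  · filter_upwards [hU] with y hy
    exact (hg.integrable_tailMassDeriv hcd hu hq hq0 hy).aestronglyMeasurable
  · filter_upwards [hU] with y hy
    refine ae_of_all _ fun v => ?_
    have hqv : Continuous (q v) := hq.comp (by fun_prop : Continuous fun t => (v, t))
    refine (hg.hasFDerivAt_tailMass (hcd.differentiable one_ne_zero) hqv (hq0 v) hy).le_of_lip'
      hK0 ?_
    filter_upwards [hg.isOpen.mem_nhds hy] with z hz using hK v y hy z hz
  · exact ((hg.continuousOn_tailMassDeriv hcd hu hq hq0).comp (f := fun y : H => (y, v))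
      (by fun_prop) fun y hy => ⟨hy, mem_univ v⟩).continuousAt hU

theorem contDiffOn_integral_tailMass (hg : SlaterOn g U ε δ M) (hcd : ContDiff ℝ 1 g)
    (hu : Continuous u) (hq : Continuous fun p : T × ℝ => q p.1 p.2) (hq0 : ∀ v, q v 0 = 0) :
    ContDiffOn ℝ 1 (fun x => ∫ v, tailMass q g u x v ∂μ) U := by
  have hderiv := fun x hx => hg.hasFDerivAt_integral_tailMass (μ := μ) (x := x) hcd hu hq hq0 hx
  rw [← zero_add (1 : WithTop ℕ∞), contDiffOn_succ_iff_fderiv_of_isOpen hg.isOpen]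
  refine ⟨fun x hx => (hderiv x hx).differentiableAt.differentiableWithinAt, by simp, ?_⟩
  rw [contDiffOn_zero]
  exact (hg.continuousOn_integral_tailMassDeriv hcd hu hq hq0).congr fun x hx =>
    (hderiv x hx).fderiv

end SlaterOn

end TailMass

section RadialDensity

theorem continuous_ite_comp_inv_smul {T Z : Type*} [TopologicalSpace T] [NormedAddCommGroup Z]
    [NormedSpace ℝ Z] {F : Z → ℝ} (hF : Continuous F)
    (hF0 : Tendsto F (Bornology.cobounded Z) (𝓝 0)) {u : T → Z} (hu : Continuous u)
    (hu0 : ∀ v, u v ≠ 0) :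
    Continuous fun p : T × ℝ => if 0 < p.2 then F (p.2⁻¹ • u p.1) else 0 := by
  have hu' : Continuous fun p : T × ℝ => u p.1 := hu.comp continuous_fst
  refine continuous_if' (fun p hp => ?_) (fun p hp => ?_) ?_ continuousOn_const
  · have hp0 : p.2 = 0 := (frontier_lt_subset_eq continuous_const continuous_snd hp).symm
    rw [if_neg hp0.not_gt]
    refine hF0.comp (tendsto_norm_atTop_iff_cobounded.1 ?_)
    have hinv : Tendsto (fun q : T × ℝ => q.2⁻¹) (𝓝[{q | 0 < q.2}] p) atTop :=
      tendsto_inv_nhdsGT_zero.comp (tendsto_nhdsWithin_iff.2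
        ⟨hp0 ▸ (continuous_snd.tendsto p).mono_left nhdsWithin_le_nhds, self_mem_nhdsWithin⟩)
    refine (hinv.atTop_mul_pos (norm_pos_iff.2 (hu0 p.1))
      ((hu'.norm.tendsto p).mono_left nhdsWithin_le_nhds)).congr' ?_
    filter_upwards [self_mem_nhdsWithin] with q (hq : 0 < q.2)
    rw [norm_smul, norm_inv, Real.norm_of_nonneg hq.le]
  · have hp0 : p.2 = 0 := (frontier_lt_subset_eq continuous_const continuous_snd hp).symm
    rw [if_neg hp0.not_gt]
    exact tendsto_const_nhds
  · exact hF.comp_continuousOn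
      ((continuousOn_snd.inv₀ fun p (hp : 0 < p.2) => hp.ne').smul hu'.continuousOn)

variable {m : ℕ}

/-- The density `θ(·, v)` in the reciprocal radial variable: `θ(t⁻¹, v) t⁻²` for `t > 0`, extended
by zero to `t ≤ 0`. -/
def radialDensity (L : Matrix (Fin m) (Fin m) ℝ) (f : Euc m → ℝ) (v : Sph m) (t : ℝ) : ℝ :=
  if 0 < t then theta L f t⁻¹ v / t ^ 2 else 0

variable {L : Matrix (Fin m) (Fin m) ℝ} {f : Euc m → ℝ}

theorem radialDensity_zero (v : Sph m) : radialDensity L f v 0 = 0 := if_neg (lt_irrefl 0)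

theorem radialDensity_nonneg (hm : 1 ≤ m) (hf : ∀ z, 0 ≤ f z) (v : Sph m) (t : ℝ) :
    0 ≤ radialDensity L f v t := by
  have : 0 < Real.Gamma ((m : ℝ) / 2) := Real.Gamma_pos_of_pos (by positivity)
  rw [radialDensity]
  split_ifs with ht
  · have := hf (ray L t⁻¹ v)
    rw [theta]
    positivity
  · exact le_rfl

theorem det_toEuclideanLin (L : Matrix (Fin m) (Fin m) ℝ) :
    LinearMap.det (Matrix.toEuclideanLin L) = L.det := LinearMap.det_toLpLin 2 L

theorem continuous_toEuclideanLin (L : Matrix (Fin m) (Fin m) ℝ) :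
    Continuous (Matrix.toEuclideanLin L) := LinearMap.continuous_of_finiteDimensional _

theorem toEuclideanLin_ne_zero (hL : L.det ≠ 0) {z : Euc m} (hz : z ≠ 0) :
    Matrix.toEuclideanLin L z ≠ 0 :=
  have hdet : LinearMap.det (Matrix.toEuclideanLin L) ≠ 0 := by rwa [det_toEuclideanLin]
  (map_ne_zero_iff _ (LinearMap.equivOfDetNeZero _ hdet).injective).2 hz

-- The norm power absorbs `r ^ (m - 1)` and the Jacobian `t⁻²` of `r = t⁻¹`.
theorem radialDensity_eq (hm : 1 ≤ m) (hL : L.det ≠ 0) (v : Sph m) (t : ℝ) :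
    radialDensity L f v t =
      2 * Real.pi ^ ((m : ℝ) / 2) * |L.det| / Real.Gamma ((m : ℝ) / 2) /
          ‖Matrix.toEuclideanLin L (v : Euc m)‖ ^ (m + 1) *
        if 0 < t then ‖t⁻¹ • Matrix.toEuclideanLin L (v : Euc m)‖ ^ (m + 1) *
          f (t⁻¹ • Matrix.toEuclideanLin L (v : Euc m)) else 0 := by
  have hn : 0 < ‖Matrix.toEuclideanLin L (v : Euc m)‖ :=
    norm_pos_iff.2 (toEuclideanLin_ne_zero hL (ne_zero_of_mem_unit_sphere v))
  obtain ⟨n, rfl⟩ : ∃ n, m = n + 1 := ⟨m - 1, by lia⟩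
  rw [radialDensity]
  split_ifs with ht
  · rw [theta, norm_smul, norm_inv, Real.norm_of_nonneg ht.le, mul_pow, Nat.add_sub_cancel, ray,
      inv_pow, inv_pow]
    field_simp
    ring
  · rw [mul_zero]

theorem continuous_radialDensity (hm : 1 ≤ m) (hL : L.det ≠ 0) (hf : Continuous f)
    (hgrowth : Tendsto (fun z : Euc m => ‖z‖ ^ (m + 1) * f z) (Bornology.cobounded (Euc m)) (𝓝 0)) :
    Continuous fun p : Sph m × ℝ => radialDensity L f p.1 p.2 := by
  have hu : Continuous fun v : Sph m => Matrix.toEuclideanLin L (v : Euc m) :=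
    (continuous_toEuclideanLin L).comp continuous_subtype_val
  have hu0 (v : Sph m) : Matrix.toEuclideanLin L (v : Euc m) ≠ 0 :=
    toEuclideanLin_ne_zero hL (ne_zero_of_mem_unit_sphere v)
  have hcoef : Continuous fun p : Sph m × ℝ =>
      2 * Real.pi ^ ((m : ℝ) / 2) * |L.det| / Real.Gamma ((m : ℝ) / 2) /
        ‖Matrix.toEuclideanLin L (p.1 : Euc m)‖ ^ (m + 1) :=
    continuous_const.div ((hu.comp continuous_fst).norm.pow _)
      fun p => pow_ne_zero _ (norm_ne_zero_iff.2 (hu0 p.1))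
  have hF : Continuous fun z : Euc m => ‖z‖ ^ (m + 1) * f z := (continuous_norm.pow _).mul hf
  exact (hcoef.mul (continuous_ite_comp_inv_smul hF hgrowth hu hu0)).congr
    fun p => (radialDensity_eq hm hL p.1 p.2).symm

end RadialDensity

section PolarCoordinates

theorem lintegral_eq_lintegral_toSphere {E : Type*} [NormedAddCommGroup E] [NormedSpace ℝ E]
    [MeasurableSpace E] [BorelSpace E] [FiniteDimensional ℝ E] [Nontrivial E] (μ : Measure E)
    [μ.IsAddHaarMeasure] {F : E → ENNReal} (hF : Measurable F) :
    ∫⁻ x, F x ∂μ = ∫⁻ v, (∫⁻ r in Ioi (0 : ℝ),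
      ENNReal.ofReal (r ^ (Module.finrank ℝ E - 1)) * F (r • (v : E))) ∂μ.toSphere := by
  calc ∫⁻ x, F x ∂μ = ∫⁻ x : ({(0)}ᶜ : Set E), F x ∂(μ.comap (↑)) := by
        rw [lintegral_subtype_comap (measurableSet_singleton _).compl, restrict_compl_singleton]
    _ = ∫⁻ q : Metric.sphere (0 : E) 1 × Ioi (0 : ℝ), F (q.2.1 • (q.1 : E))
          ∂μ.toSphere.prod (.volumeIoiPow (Module.finrank ℝ E - 1)) := by
        rw [← μ.measurePreserving_homeomorphUnitSphereProd.lintegral_comp_emb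
          (Homeomorph.measurableEmbedding _)]
        refine lintegral_congr fun x => congrArg F ?_
        exact (congrArg Subtype.val ((homeomorphUnitSphereProd E).symm_apply_apply x)).symm
    _ = ∫⁻ v, (∫⁻ r : Ioi (0 : ℝ), F (r.1 • (v : E))
          ∂(.volumeIoiPow (Module.finrank ℝ E - 1))) ∂μ.toSphere :=
        lintegral_prod _ (hF.comp (by fun_prop)).aemeasurable
    _ = _ := by
        refine lintegral_congr fun v => ?_
        have hFv : Measurable fun r : Ioi (0 : ℝ) => F (r.1 • (v : E)) := hF.comp (by fun_prop)
        rw [Measure.volumeIoiPow, lintegral_withDensity_eq_lintegral_mul _ (by fun_prop) hFv]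
        exact lintegral_subtype_comap measurableSet_Ioi
          fun r : ℝ => ENNReal.ofReal (r ^ (Module.finrank ℝ E - 1)) * F (r • (v : E))

theorem lintegral_Ioi_comp_inv (F : ℝ → ENNReal) :
    ∫⁻ r in Ioi (0 : ℝ), F r = ∫⁻ t in Ioi (0 : ℝ), ENNReal.ofReal (t ^ 2)⁻¹ * F t⁻¹ := by
  have himage : (fun t : ℝ => t⁻¹) '' Ioi 0 = Ioi 0 := by
    ext t
    simp
  have h := lintegral_image_eq_lintegral_abs_deriv_mul measurableSet_Ioi
    (fun t (ht : t ∈ Ioi (0 : ℝ)) => (hasDerivAt_inv (ne_of_gt ht)).hasDerivWithinAt)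
    inv_injective.injOn F
  simpa [himage] using h

variable {m : ℕ}

theorem toSphere_univ (hm : 1 ≤ m) : (volume : Measure (Euc m)).toSphere univ
    = ENNReal.ofReal (2 * Real.pi ^ ((m : ℝ) / 2) / Real.Gamma ((m : ℝ) / 2)) := by
  have : Nonempty (Fin m) := ⟨⟨0, hm⟩⟩
  have hm0 : (m : ℝ) / 2 ≠ 0 := by positivity
  have : 0 < Real.Gamma ((m : ℝ) / 2) := Real.Gamma_pos_of_pos (by positivity)
  have hpow : √Real.pi ^ m = Real.pi ^ ((m : ℝ) / 2) := by
    rw [Real.sqrt_eq_rpow, ← Real.rpow_natCast, ← Real.rpow_mul Real.pi_pos.le]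
    congr 1
    ring
  rw [Measure.toSphere_apply_univ, EuclideanSpace.volume_ball, Fintype.card_fin,
    finrank_euclideanSpace_fin, ENNReal.ofReal_one, one_pow, one_mul, ← ENNReal.ofReal_natCast,
    ← ENNReal.ofReal_mul (by positivity), Real.Gamma_add_one hm0, hpow]
  congr 1
  field_simp

theorem toSphere_univ_ne_zero (hm : 1 ≤ m) : (volume : Measure (Euc m)).toSphere univ ≠ 0 :=
  have : Nonempty (Fin m) := ⟨⟨0, hm⟩⟩
  Measure.measure_univ_ne_zero.2 (Measure.toSphere_ne_zero _)

theorem isProbabilityMeasure_sphereUnif (hm : 1 ≤ m) : IsProbabilityMeasure (sphereUnif m) :=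
  ⟨ENNReal.inv_mul_cancel (toSphere_univ_ne_zero hm) (measure_ne_top _ _)⟩

theorem toSphere_eq_smul_sphereUnif (hm : 1 ≤ m) : (volume : Measure (Euc m)).toSphere =
    (volume : Measure (Euc m)).toSphere univ • sphereUnif m := by
  rw [sphereUnif, smul_smul,
    ENNReal.mul_inv_cancel (toSphere_univ_ne_zero hm) (measure_ne_top _ _), one_smul]

variable {L : Matrix (Fin m) (Fin m) ℝ} {f : Euc m → ℝ}

theorem lintegral_comp_toEuclideanLin (hL : L.det ≠ 0) {F : Euc m → ENNReal} (hF : Measurable F) :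
    ∫⁻ z, F z = ENNReal.ofReal |L.det| * ∫⁻ z, F (Matrix.toEuclideanLin L z) := by
  have hdet : LinearMap.det (Matrix.toEuclideanLin L) ≠ 0 := by rwa [det_toEuclideanLin]
  rw [← lintegral_map hF (continuous_toEuclideanLin L).measurable,
    Measure.map_linearMap_addHaar_eq_smul_addHaar _ hdet, lintegral_smul_measure, smul_eq_mul,
    ← mul_assoc, ← ENNReal.ofReal_mul (abs_nonneg _), det_toEuclideanLin, ← abs_mul,
    mul_inv_cancel₀ hL, abs_one, ENNReal.ofReal_one, one_mul]

theorem lintegral_eq_lintegral_sphereUnif (hm : 1 ≤ m) (hL : L.det ≠ 0) {F : Euc m → ENNReal}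
    (hF : Measurable F) :
    ∫⁻ z, F z = ∫⁻ v, (∫⁻ r in Ioi (0 : ℝ),
      ENNReal.ofReal (2 * Real.pi ^ ((m : ℝ) / 2) * |L.det| / Real.Gamma ((m : ℝ) / 2) *
        r ^ (m - 1)) * F (ray L r v)) ∂(sphereUnif m) := by
  have : Nonempty (Fin m) := ⟨⟨0, hm⟩⟩
  have : 0 < Real.Gamma ((m : ℝ) / 2) := Real.Gamma_pos_of_pos (by positivity)
  have hpolar := lintegral_eq_lintegral_toSphere volume
    (hF.comp (continuous_toEuclideanLin L).measurable)
  simp only [Function.comp_apply, finrank_euclideanSpace_fin, map_smul] at hpolar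
  rw [lintegral_comp_toEuclideanLin hL hF, hpolar, toSphere_eq_smul_sphereUnif hm,
    lintegral_smul_measure, smul_eq_mul, ← lintegral_const_mul' _ _ (measure_ne_top _ _),
    ← lintegral_const_mul' _ _ ENNReal.ofReal_ne_top]
  refine lintegral_congr fun v => ?_
  rw [← lintegral_const_mul' _ _ (measure_ne_top _ _),
    ← lintegral_const_mul' _ _ ENNReal.ofReal_ne_top]
  refine setLIntegral_congr_fun measurableSet_Ioi fun r (_ : 0 < r) => ?_
  rw [← ray, toSphere_univ hm, ← mul_assoc, ← mul_assoc, ← ENNReal.ofReal_mul (by positivity),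
    ← ENNReal.ofReal_mul (by positivity)]
  congr 2
  ring

theorem withDensity_apply_eq_lintegral_theta (hm : 1 ≤ m) (hL : L.det ≠ 0) (hf : Measurable f)
    {B : Set (Euc m)} (hB : MeasurableSet B) :
    (volume : Measure (Euc m)).withDensity (fun z => ENNReal.ofReal (f z)) B =
      ∫⁻ v, (∫⁻ r in Ioi (0 : ℝ), {r | ray L r v ∈ B}.indicator
        (fun r => ENNReal.ofReal (theta L f r v)) r) ∂(sphereUnif m) := by
  have : 0 < Real.Gamma ((m : ℝ) / 2) := Real.Gamma_pos_of_pos (by positivity)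
  rw [withDensity_apply _ hB, ← lintegral_indicator hB,
    lintegral_eq_lintegral_sphereUnif hm hL (hf.ennreal_ofReal.indicator hB)]
  refine lintegral_congr fun v => setLIntegral_congr_fun measurableSet_Ioi fun r (_ : 0 < r) => ?_
  by_cases hrB : ray L r v ∈ B
  · rw [indicator_of_mem hrB, indicator_of_mem (show r ∈ {r | ray L r v ∈ B} from hrB), theta,
      ← ENNReal.ofReal_mul (by positivity)]
  · rw [indicator_of_notMem hrB, indicator_of_notMem (show r ∉ {r | ray L r v ∈ B} from hrB),
      mul_zero]

theorem lintegral_theta_eq_integral_radialDensity (hm : 1 ≤ m) (hf0 : ∀ z, 0 ≤ f z) {v : Sph m}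
    (hcont : Continuous (radialDensity L f v)) {s : ℝ} (hs : 0 ≤ s) :
    ∫⁻ r in Ioi (0 : ℝ), {r | 1 < r * s}.indicator (fun r => ENNReal.ofReal (theta L f r v)) r =
      ENNReal.ofReal (∫ t in 0..s, radialDensity L f v t) := by
  rw [intervalIntegral.integral_of_le hs, ofReal_integral_eq_lintegral_ofReal
    (hcont.integrableOn_Icc.mono_set Ioc_subset_Icc_self)
    (ae_of_all _ fun t => radialDensity_nonneg hm hf0 v t), lintegral_Ioi_comp_inv,
    Measure.restrict_congr_set Ioo_ae_eq_Ioc.symm, ← lintegral_indicator measurableSet_Ioo,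
    ← lintegral_indicator measurableSet_Ioi]
  refine lintegral_congr fun t => ?_
  by_cases ht : 0 < t
  · have hmem : 1 < t⁻¹ * s ↔ t < s := by rw [inv_mul_eq_div, one_lt_div ht]
    rw [indicator_of_mem (show t ∈ Ioi 0 from ht)]
    by_cases hts : t < s
    · rw [indicator_of_mem (show t ∈ Ioo 0 s from ⟨ht, hts⟩),
        indicator_of_mem (show t⁻¹ ∈ {r | 1 < r * s} from hmem.2 hts), radialDensity, if_pos ht,
        ← ENNReal.ofReal_mul (by positivity), div_eq_inv_mul]
    · rw [indicator_of_notMem (show t ∉ Ioo 0 s from fun h => hts h.2),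
        indicator_of_notMem (show t⁻¹ ∉ {r | 1 < r * s} from fun h => hts (hmem.1 h)), mul_zero]
  · rw [indicator_of_notMem (show t ∉ Ioi 0 from ht),
      indicator_of_notMem (show t ∉ Ioo 0 s from fun h => ht h.1)]

theorem withDensity_apply_eq_integral_radialDensity (hm : 1 ≤ m) (hL : L.det ≠ 0)
    (hf : Continuous f) (hf0 : ∀ z, 0 ≤ f z)
    (hgrowth : Tendsto (fun z : Euc m => ‖z‖ ^ (m + 1) * f z) (Bornology.cobounded (Euc m)) (𝓝 0))
    {s : Sph m → ℝ} (hs : Continuous s) (hs0 : ∀ v, 0 ≤ s v) {B : Set (Euc m)}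
    (hB : MeasurableSet B) (hmem : ∀ r, 0 < r → ∀ v, ray L r v ∈ B ↔ 1 < r * s v) :
    (volume : Measure (Euc m)).withDensity (fun z => ENNReal.ofReal (f z)) B =
      ENNReal.ofReal (∫ v, (∫ t in 0..s v, radialDensity L f v t) ∂(sphereUnif m)) := by
  have := isProbabilityMeasure_sphereUnif hm
  have hq := continuous_radialDensity hm hL hf hgrowth
  have hint : Continuous fun v => ∫ t in 0..s v, radialDensity L f v t :=
    intervalIntegral.continuous_parametric_intervalIntegral_of_continuous hq hs
  rw [ofReal_integral_eq_lintegral_ofReal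
    (hint.integrable_of_hasCompactSupport (.of_compactSpace _))
    (ae_of_all _ fun v => intervalIntegral.integral_nonneg (hs0 v) fun t _ =>
      radialDensity_nonneg hm hf0 v t),
    withDensity_apply_eq_lintegral_theta hm hL hf.measurable hB]
  refine lintegral_congr fun v => ?_
  rw [← lintegral_theta_eq_integral_radialDensity hm hf0
    (hq.comp (by fun_prop : Continuous fun t => (v, t))) (hs0 v)]
  refine setLIntegral_congr_fun measurableSet_Ioi fun r hr => ?_
  simp only [indicator, hmem r hr v, mem_ofPred_eq]

end PolarCoordinates

section Direction

variable {m : ℕ}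

/-- The direction `L v` of the ray `r ↦ ray L r v`. -/
def direction (L : Matrix (Fin m) (Fin m) ℝ) (v : Sph m) : Euc m :=
  Matrix.toEuclideanLin L (v : Euc m)

theorem continuous_direction (L : Matrix (Fin m) (Fin m) ℝ) : Continuous (direction L) :=
  (continuous_toEuclideanLin L).comp continuous_subtype_val

end Direction

section SupFunction

variable {H Y : Type*} [NormedAddCommGroup Y] [NormedSpace ℝ Y] {m : ℕ}
  {C : Set (WeakDual ℝ Y)} {Φ : H → Euc m → Y} {h : H → ℝ} {lam : ℝ} {v : WeakDual ℝ Y}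

theorem nonempty_of_closure_coneOf {K : Set Y} (hgen : closure (coneOf C) = posDual K) :
    C.Nonempty := by
  have hzero : (0 : WeakDual ℝ Y) ∈ closure (coneOf C) := hgen ▸ fun y _ => le_refl (0 : ℝ)
  obtain ⟨_, _, _, v, hv, _⟩ := closure_nonempty_iff.1 ⟨_, hzero⟩
  exact ⟨v, hv⟩

theorem continuous_scal (Φ : H → Euc m → Y) (h : H → ℝ) (w : Prod2 H m) :
    Continuous fun v => scal Φ h v w :=
  (WeakDual.eval_continuous _).add continuous_const

theorem concaveOn_scal (hC : Convex ℝ C) (w : Prod2 H m) :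
    ConcaveOn ℝ C fun v => scal Φ h v w :=
  ConcaveOn.add_const ⟨hC, fun _ _ _ _ _ _ _ _ _ => le_rfl⟩ (h w.fst)

theorem isLUB_supFun (hC : IsCompact C) (hne : C.Nonempty) (w : Prod2 H m) :
    IsLUB ((fun v => scal Φ h v w) '' C) (supFun Φ h C w) := by
  rw [supFun, ← sSup_image' (f := fun v => scal Φ h v w)]
  exact isLUB_csSup (hne.image _) (hC.bddAbove_image (continuous_scal Φ h w).continuousOn)

variable [NormedAddCommGroup H] [InnerProductSpace ℝ H]

theorem convexOn_supFun (hC : IsCompact C) (hne : C.Nonempty)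
    (hΦ : ∀ v ∈ C, ConvexOn ℝ univ (scal Φ h v)) : ConvexOn ℝ univ (supFun Φ h C) :=
  convexOn_of_isLUB hΦ (isLUB_supFun hC hne)

variable [FiniteDimensional ℝ H]

theorem exists_moreau_scal_eq_supEnv (hC : IsCompact C) (hCconv : Convex ℝ C) (hne : C.Nonempty)
    (hΦ : ∀ v ∈ C, ConvexOn ℝ univ (scal Φ h v)) (hlam : 0 < lam) (w : Prod2 H m) :
    ∃ v ∈ C, moreau lam (scal Φ h v) w = supEnv Φ h C lam w :=
  exists_moreau_eq_of_isLUB hC hCconv hne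
    (fun y => (continuous_scal Φ h y).upperSemicontinuous.upperSemicontinuousOn C)
    (concaveOn_scal hCconv) hΦ (isLUB_supFun hC hne) hlam w

theorem hasGradientAt_supEnv_of_active [CompleteSpace H] (hC : IsCompact C)
    (hΦ : ∀ v ∈ C, ConvexOn ℝ univ (scal Φ h v)) (hlam : 0 < lam) (hv : v ∈ C) {w : Prod2 H m}
    (hactive : moreau lam (scal Φ h v) w = supEnv Φ h C lam w) :
    ∃ p, proxSet lam (scal Φ h v) w = {p} ∧
      HasGradientAt (supEnv Φ h C lam) (lam⁻¹ • (w - p)) w := by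
  have hS := convexOn_supFun hC ⟨v, hv⟩ hΦ
  obtain ⟨p, hp⟩ := proxSet_nonempty hS hlam w
  have hle : scal Φ h v ≤ supFun Φ h C := fun y =>
    (isLUB_supFun hC ⟨v, hv⟩ y).1 (mem_image_of_mem _ hv)
  have hpv : p ∈ proxSet lam (scal Φ h v) w :=
    mem_proxSet_of_le_of_moreau_eq hle (proxSet_nonempty (hΦ v hv) hlam w) hp hactive
  exact ⟨p, (proxSet_subsingleton (hΦ v hv) hlam w).eq_singleton_of_mem hpv,
    hasGradientAt_moreau hS hlam (proxSet_nonempty hS hlam) hp⟩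

end SupFunction

section Constraint

variable {H : Type*} {m : ℕ}

/-- The constraint function `(x, z) ↦ E(x, z) - h(x)`, on the product with the sup norm, so that
`E(x, z) ≤ h(x)` is a sublevel condition in `z`. -/
def constraint (E : Prod2 H m → ℝ) (h : H → ℝ) (p : H × Euc m) : ℝ := E (pair p.1 p.2) - h p.1

variable [NormedAddCommGroup H] [NormedSpace ℝ H] {E : Prod2 H m → ℝ} {h : H → ℝ} {x : H}
  {z : Euc m}

theorem convexOn_constraint (hE : ConvexOn ℝ univ E) (h : H → ℝ) (x : H) :
    ConvexOn ℝ univ fun z => constraint E h (x, z) := by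
  refine ConvexOn.add_const ⟨convex_univ, fun z _ z' _ a b ha hb hab => ?_⟩ (-h x)
  have hpair : pair x (a • z + b • z') = a • (pair x z : Prod2 H m) + b • pair x z' :=
    congrArg (WithLp.toLp 2) (Prod.ext (Convex.combo_self hab x).symm rfl)
  rw [hpair]
  exact hE.2 (mem_univ _) (mem_univ _) ha hb hab

theorem contDiff_constraint (hE : ContDiff ℝ 1 E) (hh : ContDiff ℝ 1 h) :
    ContDiff ℝ 1 (constraint E h) :=
  (hE.comp (WithLp.prodContinuousLinearEquiv 2 ℝ H (Euc m)).symm.contDiff).sub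
    (hh.comp contDiff_fst)

theorem hasFDerivAt_constraint (hE : DifferentiableAt ℝ E (pair x z))
    (hh : DifferentiableAt ℝ h x) :
    HasFDerivAt (constraint E h)
      ((fderiv ℝ E (pair x z)).comp
          (WithLp.prodContinuousLinearEquiv 2 ℝ H (Euc m)).symm.toContinuousLinearMap -
        (fderiv ℝ h x).comp (.fst ℝ H (Euc m))) (x, z) :=
  (hE.hasFDerivAt.comp (x, z)
    (WithLp.prodContinuousLinearEquiv 2 ℝ H (Euc m)).symm.hasFDerivAt).sub
    (hh.hasFDerivAt.comp (x, z) hasFDerivAt_fst)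

theorem exists_norm_fderiv_constraint_le (hE : Differentiable ℝ E) (hh : ContDiff ℝ 1 h) {k : ℝ}
    (hlip : ∀ w w', ‖fderiv ℝ E w - fderiv ℝ E w'‖ ≤ k * ‖w - w'‖) (xbar : H) :
    ∃ M : ℝ, ∀ᶠ x in 𝓝 xbar, ∀ z : Euc m,
      ‖fderiv ℝ (constraint E h) (x, z)‖ ≤ M * (1 + ‖z‖) := by
  set e := (WithLp.prodContinuousLinearEquiv 2 ℝ H (Euc m)).symm.toContinuousLinearMap with he
  set A := ‖fderiv ℝ E (pair xbar 0)‖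
  set B := ‖fderiv ℝ h xbar‖ + 1
  have hfderiv_h : ∀ᶠ x in 𝓝 xbar, ‖fderiv ℝ h x‖ < B :=
    (hh.continuous_fderiv one_ne_zero).norm.continuousAt.eventually_lt continuousAt_const
      (lt_add_one _)
  refine ⟨(A + |k| * ‖e‖) * ‖e‖ + B, ?_⟩
  filter_upwards [hfderiv_h, Metric.ball_mem_nhds xbar one_pos] with x hB hx z
  have hdist : ‖(pair x z : Prod2 H m) - pair xbar 0‖ ≤ ‖e‖ * (1 + ‖z‖) := by
    refine (e.le_opNorm (x - xbar, z - 0)).trans ?_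
    gcongr
    rw [sub_zero, Prod.norm_mk, ← dist_eq_norm]
    exact max_le (by linarith [Metric.mem_ball.1 hx, norm_nonneg z]) (by linarith)
  have hfderiv_E : ‖fderiv ℝ E (pair x z)‖ ≤ A + |k| * (‖e‖ * (1 + ‖z‖)) :=
    calc ‖fderiv ℝ E (pair x z)‖
        ≤ A + ‖fderiv ℝ E (pair x z) - fderiv ℝ E (pair xbar 0)‖ := norm_le_norm_add_norm_sub' _ _
      _ ≤ A + |k| * (‖e‖ * (1 + ‖z‖)) := by
        gcongr
        exact (hlip _ _).trans (mul_le_mul (le_abs_self k) hdist (norm_nonneg _) (abs_nonneg k))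
  rw [(hasFDerivAt_constraint (hE _) (hh.differentiable one_ne_zero x)).fderiv, ← he]
  calc ‖(fderiv ℝ E (pair x z)).comp e - (fderiv ℝ h x).comp (.fst ℝ H (Euc m))‖
      ≤ ‖fderiv ℝ E (pair x z)‖ * ‖e‖ + ‖fderiv ℝ h x‖ * 1 :=
        (norm_sub_le _ _).trans <| add_le_add (ContinuousLinearMap.opNorm_comp_le _ _) <|
          (ContinuousLinearMap.opNorm_comp_le _ _).trans <|
            mul_le_mul_of_nonneg_left (ContinuousLinearMap.norm_fst_le _ _ _) (norm_nonneg _)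
    _ ≤ (A + |k| * (‖e‖ * (1 + ‖z‖))) * ‖e‖ + B * 1 := by gcongr
    _ ≤ ((A + |k| * ‖e‖) * ‖e‖ + B) * (1 + ‖z‖) := by
        have : 0 ≤ (A * ‖e‖ + B) * ‖z‖ := by positivity
        linarith

theorem inner_gradient_snd (hdiff : DifferentiableAt ℝ (constraint E h) (x, z)) (a : Euc m) :
    inner ℝ (gradient (fun y => E (pair x y)) z) a = fderiv ℝ (constraint E h) (x, z) (0, a) := by
  have hpartial := (hdiff.hasFDerivAt.comp z (hasFDerivAt_prodMk_right x z)).add_const (h x)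
  have hE : HasFDerivAt (fun y => E (pair x y)) _ z :=
    hpartial.congr_of_eventuallyEq (.of_forall fun y => (sub_add_cancel _ _).symm)
  rw [inner_gradient_left, hE.fderiv]
  rfl

end Constraint

section Specialization

variable {H Y : Type*} [NormedAddCommGroup H] [NormedAddCommGroup Y] [NormedSpace ℝ Y] {m : ℕ}
  {Φ : H → Euc m → Y} {h : H → ℝ} {C : Set (WeakDual ℝ Y)} {lam : ℝ}
  {U : Set H} {ε δ M : ℝ} {L : Matrix (Fin m) (Fin m) ℝ} {f : Euc m → ℝ} {x : H} {v : Sph m}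

theorem supEnv_ray_le_iff (hg : SlaterOn (constraint (supEnv Φ h C lam) h) U ε δ M) (hx : x ∈ U)
    {r : ℝ} (hr : 0 ≤ r) : supEnv Φ h C lam (pair x (ray L r v)) ≤ h x ↔
      r * levelGauge (constraint (supEnv Φ h C lam) h) x (direction L v) ≤ 1 := by
  rw [← levelGauge_smul _ _ hr, hg.levelGauge_le_one_iff hx, constraint, sub_nonpos]
  rfl

theorem supEnv_ray_eq_iff (hg : SlaterOn (constraint (supEnv Φ h C lam) h) U ε δ M) (hx : x ∈ U)
    {r : ℝ} (hr : 0 ≤ r) : supEnv Φ h C lam (pair x (ray L r v)) = h x ↔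
      r * levelGauge (constraint (supEnv Φ h C lam) h) x (direction L v) = 1 := by
  rw [← levelGauge_smul _ _ hr, hg.levelGauge_eq_one_iff hx, constraint, sub_eq_zero]
  rfl

theorem mem_finDir_iff (hg : SlaterOn (constraint (supEnv Φ h C lam) h) U ε δ M) (hx : x ∈ U) :
    v ∈ finDir Φ h C L lam x ↔
      0 < levelGauge (constraint (supEnv Φ h C lam) h) x (direction L v) := by
  constructor
  · rintro ⟨r, hr, hE⟩
    exact pos_of_mul_pos_right (one_pos.trans_eq ((supEnv_ray_eq_iff hg hx hr.le).1 hE).symm) hr.le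
  · exact fun hpos => ⟨_, inv_pos.2 hpos,
      (supEnv_ray_eq_iff hg hx (inv_nonneg.2 hpos.le)).2 (inv_mul_cancel₀ hpos.ne')⟩

theorem toReal_rho_eq_inv_levelGauge (hg : SlaterOn (constraint (supEnv Φ h C lam) h) U ε δ M)
    (hx : x ∈ U) (hpos : 0 < levelGauge (constraint (supEnv Φ h C lam) h) x (direction L v)) :
    (rho Φ h C L lam x v).toReal =
      (levelGauge (constraint (supEnv Φ h C lam) h) x (direction L v))⁻¹ := by
  set s := levelGauge (constraint (supEnv Φ h C lam) h) x (direction L v)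
  have hmax : IsGreatest {t : EReal | ∃ r : ℝ, 0 < r ∧
      supEnv Φ h C lam (pair x (ray L r v)) ≤ h x ∧ t = (r : EReal)} ((s⁻¹ : ℝ) : EReal) := by
    refine ⟨⟨_, inv_pos.2 hpos, ?_, rfl⟩, ?_⟩
    · exact (supEnv_ray_le_iff hg hx (inv_nonneg.2 hpos.le)).2 (inv_mul_cancel₀ hpos.ne').le
    · rintro _ ⟨r, hr, hE, rfl⟩
      rw [EReal.coe_le_coe_iff, ← one_div, le_div_iff₀ hpos]
      exact (supEnv_ray_le_iff hg hx hr.le).1 hE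
  rw [rho, hmax.isLUB.sSup_eq, EReal.toReal_coe]

variable {Ω : Type*} [MeasurableSpace Ω] {P : Measure Ω} [IsFiniteMeasure P] {ξ : Ω → Euc m}

theorem regProb_eq_measureReal_sub_integral (hξ : Measurable ξ)
    (hdens : P.map ξ = (volume : Measure (Euc m)).withDensity fun z => ENNReal.ofReal (f z))
    (hm : 1 ≤ m) (hL : L.det ≠ 0) (hf : Continuous f) (hf0 : ∀ z, 0 ≤ f z)
    (hgrowth : Tendsto (fun z : Euc m => ‖z‖ ^ (m + 1) * f z) (Bornology.cobounded (Euc m)) (𝓝 0))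
    (hg : SlaterOn (constraint (supEnv Φ h C lam) h) U ε δ M) (hx : x ∈ U) :
    regProb P ξ Φ h C lam x = P.real univ -
      ∫ v, tailMass (radialDensity L f) (constraint (supEnv Φ h C lam) h) (direction L) x v
        ∂(sphereUnif m) := by
  set g := constraint (supEnv Φ h C lam) h
  have hB : MeasurableSet {z | g (x, z) ≤ 0} :=
    (isClosed_le (hg.continuous x hx) continuous_const).measurableSet
  have hpolar := withDensity_apply_eq_integral_radialDensity hm hL hf hf0 hgrowth
    (s := fun v => levelGauge g x (direction L v))
    ((continuous_gauge (hg.convex_sublevel hx) (hg.sublevel_mem_nhds hx)).comp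
      (continuous_direction L)) (fun v => levelGauge_nonneg _ _ _) hB.compl
    fun r hr v => by
      rw [← not_le, ← supEnv_ray_le_iff hg hx hr.le, ← sub_nonpos]
      rfl
  rw [← hdens, Measure.map_apply hξ hB.compl, preimage_compl] at hpolar
  have hcompl : P.real (ξ ⁻¹' {z | g (x, z) ≤ 0})ᶜ =
      ∫ v, tailMass (radialDensity L f) g (direction L) x v ∂(sphereUnif m) := by
    rw [measureReal_def, hpolar, ENNReal.toReal_ofReal]
    · rfl
    · exact integral_nonneg fun v => intervalIntegral.integral_nonneg (levelGauge_nonneg _ _ _)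
        fun t _ => radialDensity_nonneg hm hf0 v t
  rw [← hcompl, measureReal_compl (hξ hB), sub_sub_cancel, regProb]
  congr 1
  ext ω
  exact (sub_nonpos (a := supEnv Φ h C lam (pair x (ξ ω)))).symm

theorem contDiffOn_regProb [NormedSpace ℝ H] (hξ : Measurable ξ)
    (hdens : P.map ξ = (volume : Measure (Euc m)).withDensity fun z => ENNReal.ofReal (f z))
    (hm : 1 ≤ m) (hL : L.det ≠ 0) (hf : Continuous f) (hf0 : ∀ z, 0 ≤ f z)
    (hgrowth : Tendsto (fun z : Euc m => ‖z‖ ^ (m + 1) * f z) (Bornology.cobounded (Euc m)) (𝓝 0))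
    (hg : SlaterOn (constraint (supEnv Φ h C lam) h) U ε δ M)
    (hcd : ContDiff ℝ 1 (constraint (supEnv Φ h C lam) h)) :
    ContDiffOn ℝ 1 (regProb P ξ Φ h C lam) U := by
  have := isProbabilityMeasure_sphereUnif hm
  have hq := continuous_radialDensity hm hL hf hgrowth
  exact (contDiffOn_const.sub (hg.contDiffOn_integral_tailMass hcd (continuous_direction L) hq
    radialDensity_zero)).congr fun x hx =>
      regProb_eq_measureReal_sub_integral hξ hdens hm hL hf hf0 hgrowth hg hx

variable [InnerProductSpace ℝ H] [CompleteSpace H]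

theorem toDual_gradient_fst_sub {E : Prod2 H m → ℝ} {z : Euc m}
    (hdiff : DifferentiableAt ℝ (constraint E h) (x, z)) (hh : DifferentiableAt ℝ h x) :
    InnerProductSpace.toDual ℝ H (gradient (fun y => E (pair y z)) x - gradient h x) =
      (fderiv ℝ (constraint E h) (x, z)).comp (.inl ℝ H (Euc m)) := by
  have hpartial := (hdiff.hasFDerivAt.comp x (hasFDerivAt_prodMk_left x z)).add hh.hasFDerivAt
  have hE : HasFDerivAt (fun y => E (pair y z)) _ x :=
    hpartial.congr_of_eventuallyEq (.of_forall fun y => (sub_add_cancel _ _).symm)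
  rw [gradient, gradient, map_sub, LinearIsometryEquiv.apply_symm_apply,
    LinearIsometryEquiv.apply_symm_apply, hE.fderiv, add_sub_cancel_right]

theorem toDual_gradLike (hg : SlaterOn (constraint (supEnv Φ h C lam) h) U ε δ M)
    (hdiff : Differentiable ℝ (constraint (supEnv Φ h C lam) h)) (hh : Differentiable ℝ h)
    (hx : x ∈ U) (v : Sph m) :
    InnerProductSpace.toDual ℝ H (gradLike Φ h C L f lam x v) =
      -tailMassDeriv (radialDensity L f) (constraint (supEnv Φ h C lam) h) (direction L) x v := by
  rcases (levelGauge_nonneg (constraint (supEnv Φ h C lam) h) x (direction L v)).eq_or_lt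
    with hzero | hpos
  · rw [gradLike, if_neg (by rw [mem_finDir_iff hg hx, ← hzero]; exact lt_irrefl 0),
      tailMassDeriv_of_levelGauge_eq_zero hzero.symm, map_zero, neg_zero]
  · rw [gradLike, if_pos ((mem_finDir_iff hg hx).2 hpos), toReal_rho_eq_inv_levelGauge hg hx hpos,
      gradLikeAt, map_smulₛₗ, conj_trivial, toDual_gradient_fst_sub (hdiff _) (hh x),
      inner_gradient_snd (hdiff _), tailMassDeriv, levelGaugeDeriv, radialDensity, if_pos hpos,
      smul_smul, div_mul_div_cancel₀ (pow_ne_zero 2 hpos.ne'), neg_div, neg_smul]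
    rfl

variable {μ : Measure (Sph m)} [IsFiniteMeasure μ]

theorem integrable_gradLike (hg : SlaterOn (constraint (supEnv Φ h C lam) h) U ε δ M)
    (hcd : ContDiff ℝ 1 (constraint (supEnv Φ h C lam) h)) (hh : Differentiable ℝ h)
    (hq : Continuous fun p : Sph m × ℝ => radialDensity L f p.1 p.2) (hx : x ∈ U) :
    Integrable (gradLike Φ h C L f lam x) μ := by
  have hcont : Continuous (gradLike Φ h C L f lam x) := by
    rw [← (InnerProductSpace.toDual ℝ H).comp_continuous_iff]
    exact (hg.continuous_tailMassDeriv hcd (continuous_direction L) hq radialDensity_zero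
      hx).neg.congr fun v => (toDual_gradLike hg (hcd.differentiable one_ne_zero) hh hx v).symm
  exact hcont.integrable_of_hasCompactSupport (.of_compactSpace _)

theorem toDual_integral_gradLike (hg : SlaterOn (constraint (supEnv Φ h C lam) h) U ε δ M)
    (hcd : ContDiff ℝ 1 (constraint (supEnv Φ h C lam) h)) (hh : Differentiable ℝ h)
    (hq : Continuous fun p : Sph m × ℝ => radialDensity L f p.1 p.2) (hx : x ∈ U) :
    InnerProductSpace.toDual ℝ H (∫ v, gradLike Φ h C L f lam x v ∂μ) =
      -∫ v, tailMassDeriv (radialDensity L f) (constraint (supEnv Φ h C lam) h) (direction L) x v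
        ∂μ := by
  have hint := hg.integrable_tailMassDeriv (μ := μ) hcd (continuous_direction L) hq
    radialDensity_zero hx
  ext a
  rw [InnerProductSpace.toDual_apply_apply, real_inner_comm,
    ← integral_inner (integrable_gradLike hg hcd hh hq hx), neg_apply,
    ContinuousLinearMap.integral_apply hint, ← integral_neg]
  congr with v
  rw [real_inner_comm, ← InnerProductSpace.toDual_apply_apply,
    toDual_gradLike hg (hcd.differentiable one_ne_zero) hh hx]
  rfl

theorem hasGradientAt_regProb (hξ : Measurable ξ)
    (hdens : P.map ξ = (volume : Measure (Euc m)).withDensity fun z => ENNReal.ofReal (f z))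
    (hm : 1 ≤ m) (hL : L.det ≠ 0) (hf : Continuous f) (hf0 : ∀ z, 0 ≤ f z)
    (hgrowth : Tendsto (fun z : Euc m => ‖z‖ ^ (m + 1) * f z) (Bornology.cobounded (Euc m)) (𝓝 0))
    (hg : SlaterOn (constraint (supEnv Φ h C lam) h) U ε δ M)
    (hcd : ContDiff ℝ 1 (constraint (supEnv Φ h C lam) h)) (hh : Differentiable ℝ h)
    (hx : x ∈ U) :
    HasGradientAt (regProb P ξ Φ h C lam) (∫ v, gradLike Φ h C L f lam x v ∂(sphereUnif m)) x := by
  have := isProbabilityMeasure_sphereUnif hm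
  have hq := continuous_radialDensity hm hL hf hgrowth
  rw [hasGradientAt_iff_hasFDerivAt, toDual_integral_gradLike hg hcd hh hq hx]
  refine ((hg.hasFDerivAt_integral_tailMass hcd (continuous_direction L) hq radialDensity_zero
    hx).const_sub (P.real univ)).congr_of_eventuallyEq ?_
  filter_upwards [hg.isOpen.mem_nhds hx] with y hy using
    regProb_eq_measureReal_sub_integral hξ hdens hm hL hf hf0 hgrowth hg hy

variable [FiniteDimensional ℝ H]

theorem contDiff_constraint_supEnv (hC : IsCompact C) (hne : C.Nonempty)
    (hΦ : ∀ v ∈ C, ConvexOn ℝ univ (scal Φ h v)) (hlam : 0 < lam) (hh : ContDiff ℝ 1 h) :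
    ContDiff ℝ 1 (constraint (supEnv Φ h C lam) h) :=
  have hS := convexOn_supFun hC hne hΦ
  contDiff_constraint (contDiff_moreau hS hlam (proxSet_nonempty hS hlam)) hh

theorem exists_slaterOn_constraint_supEnv (hC : IsCompact C) (hne : C.Nonempty)
    (hΦ : ∀ v ∈ C, ConvexOn ℝ univ (scal Φ h v)) (hlam : 0 < lam) (hh : ContDiff ℝ 1 h) {xbar : H}
    (hxbar : supFun Φ h C (pair xbar 0) < h xbar) :
    ∃ ε δ M : ℝ, SlaterOn (constraint (supEnv Φ h C lam) h) (Metric.ball xbar ε) ε δ M := by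
  have hS := convexOn_supFun hC hne hΦ
  have hprox := proxSet_nonempty hS hlam
  obtain ⟨M, hM⟩ := exists_norm_fderiv_constraint_le
    ((contDiff_moreau hS hlam hprox).differentiable one_ne_zero) hh
    (norm_fderiv_moreau_sub_le hS hlam hprox) xbar
  obtain ⟨p, hp⟩ := hprox (pair xbar 0)
  have hneg : constraint (supEnv Φ h C lam) h (xbar, 0) < 0 :=
    sub_neg.2 ((moreau_le_self_of_mem_proxSet hp).trans_lt hxbar)
  obtain ⟨ε, δ, hg⟩ := exists_slaterOn
    ((contDiff_constraint_supEnv hC hne hΦ hlam hh).differentiable one_ne_zero)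
    (convexOn_constraint (convexOn_moreau hS hlam hprox) h) hM hneg
  exact ⟨ε, δ, M, hg⟩

end Specialization

end ChanceMoreau

end

open ChanceMoreau in
theorem mainTheorem3_general
    {H : Type*} [NormedAddCommGroup H] [InnerProductSpace ℝ H] [CompleteSpace H]
    [FiniteDimensional ℝ H] {Y : Type*} [NormedAddCommGroup Y] [NormedSpace ℝ Y]
    {Ω : Type*} [MeasurableSpace Ω] (P : Measure Ω) [IsFiniteMeasure P] {m : ℕ} (hm : 1 ≤ m)
    (ξ : Ω → Euc m) (hξ : Measurable ξ) (f : Euc m → ℝ) (hf_cont : Continuous f)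
    (hf_nonneg : ∀ z, 0 ≤ f z)
    (hf_density : P.map ξ = (volume : Measure (Euc m)).withDensity (fun z => ENNReal.ofReal (f z)))
    (L : Matrix (Fin m) (Fin m) ℝ) (hL : L.det ≠ 0)
    (C : Set (WeakDual ℝ Y)) (hC_compact : IsCompact C) (hC_convex : Convex ℝ C)
    (hC_nonempty : C.Nonempty) (Φ : H → Euc m → Y) (h : H → ℝ) (hh_smooth : ContDiff ℝ 1 h)
    (hΦ_convex : ∀ v ∈ C, ConvexOn ℝ univ (scal Φ h v))
    (xbar : H) (hxbar : supFun Φ h C (pair xbar 0) < h xbar)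
    (hf_growth : Tendsto (fun z : Euc m => ‖z‖ ^ (m + 1) * f z) (Bornology.cobounded (Euc m)) (𝓝 0))
    (lam : ℝ) (hlam : 0 < lam) :
    (∃ U : Set H, IsOpen U ∧ xbar ∈ U ∧
      (∀ x ∈ U, supEnv Φ h C lam (pair x 0) < h x) ∧
      ContDiffOn ℝ 1 (regProb P ξ Φ h C lam) U ∧
      ∀ x ∈ U,
        Integrable (fun v => gradLike Φ h C L f lam x v) (sphereUnif m) ∧
        HasGradientAt (regProb P ξ Φ h C lam)
          (∫ v, gradLike Φ h C L f lam x v ∂(sphereUnif m)) x) ∧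
    (∀ (x : H) (z : Euc m),
      (∃ v ∈ C, moreau lam (scal Φ h v) (pair x z) = supEnv Φ h C lam (pair x z)) ∧
      ∀ v ∈ C, moreau lam (scal Φ h v) (pair x z) = supEnv Φ h C lam (pair x z) →
        ∃ p : Prod2 H m, proxSet lam (scal Φ h v) (pair x z) = {p} ∧
          HasGradientAt (supEnv Φ h C lam) (lam⁻¹ • (pair x z - p)) (pair x z)) := by
  refine ⟨?_, fun x z =>
    ⟨exists_moreau_scal_eq_supEnv hC_compact hC_convex hC_nonempty hΦ_convex hlam _,
      fun v hv hactive => hasGradientAt_supEnv_of_active hC_compact hΦ_convex hlam hv hactive⟩⟩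
  have := isProbabilityMeasure_sphereUnif hm
  have hcd := contDiff_constraint_supEnv hC_compact hC_nonempty hΦ_convex hlam hh_smooth
  have hh := hh_smooth.differentiable one_ne_zero
  have hq := continuous_radialDensity hm hL hf_cont hf_growth
  obtain ⟨ε, δ, M, hg⟩ := exists_slaterOn_constraint_supEnv hC_compact hC_nonempty hΦ_convex hlam
    hh_smooth hxbar
  refine ⟨Metric.ball xbar ε, hg.isOpen, Metric.mem_ball_self hg.radius_pos, fun x hx => ?_,
    contDiffOn_regProb hξ hf_density hm hL hf_cont hf_nonneg hf_growth hg hcd,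
    fun x hx => ⟨integrable_gradLike hg hcd hh hq hx,
      hasGradientAt_regProb hξ hf_density hm hL hf_cont hf_nonneg hf_growth hg hcd hh hx⟩⟩
  exact sub_neg.1 ((hg.slack x hx).trans_lt (neg_lt_zero.2 hg.slack_pos))

open ChanceMoreau in
theorem mainTheorem3
    {H : Type*} [NormedAddCommGroup H] [InnerProductSpace ℝ H] [CompleteSpace H]
    [FiniteDimensional ℝ H]
    {Y : Type*} [NormedAddCommGroup Y] [NormedSpace ℝ Y] [CompleteSpace Y]
    {Ω : Type*} [MeasurableSpace Ω] (P : Measure Ω) [IsProbabilityMeasure P]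
    {m : ℕ} (hm : 1 ≤ m)
    -- the random vector and its continuous density
    (ξ : Ω → Euc m) (hξ : Measurable ξ)
    (f : Euc m → ℝ) (hf_cont : Continuous f) (hf_nonneg : ∀ z, 0 ≤ f z)
    (hf_density : P.map ξ = (volume : Measure (Euc m)).withDensity (fun z => ENNReal.ofReal (f z)))
    -- the nonsingular matrix of the spherical-radial decomposition
    (L : Matrix (Fin m) (Fin m) ℝ) (hL : L.det ≠ 0)
    -- the cone and the weak-star compact convex set generating its positive dual cone
    (K : ConvexCone ℝ Y) (hK : (K : Set Y).Nonempty)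
    (C : Set (WeakDual ℝ Y)) (hC_compact : IsCompact C) (hC_convex : Convex ℝ C)
    (hC_gen : closure (coneOf C) = posDual (K : Set Y))
    -- the constraint mapping and the convexifying function
    (Φ : H → Euc m → Y) (h : H → ℝ) (hh_smooth : ContDiff ℝ 1 h) (hh_convex : ConvexOn ℝ univ h)
    (hΦ_convex : ∀ v ∈ C, ConvexOn ℝ univ (scal Φ h v))
    (xbar : H) (hxbar : supFun Φ h C (pair xbar 0) < h xbar)
    (hf_growth : Tendsto (fun z : Euc m => ‖z‖ ^ (m + 1) * f z) (Bornology.cobounded (Euc m)) (𝓝 0))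
    (lam : ℝ) (hlam : 0 < lam) :
    (∃ U : Set H, IsOpen U ∧ xbar ∈ U ∧
      (∀ x ∈ U, supEnv Φ h C lam (pair x 0) < h x) ∧
      ContDiffOn ℝ 1 (regProb P ξ Φ h C lam) U ∧
      ∀ x ∈ U,
        Integrable (fun v => gradLike Φ h C L f lam x v) (sphereUnif m) ∧
        HasGradientAt (regProb P ξ Φ h C lam)
          (∫ v, gradLike Φ h C L f lam x v ∂(sphereUnif m)) x) ∧
    (∀ (x : H) (z : Euc m),
      (∃ v ∈ C, moreau lam (scal Φ h v) (pair x z) = supEnv Φ h C lam (pair x z)) ∧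
      ∀ v ∈ C, moreau lam (scal Φ h v) (pair x z) = supEnv Φ h C lam (pair x z) →
        ∃ p : Prod2 H m, proxSet lam (scal Φ h v) (pair x z) = {p} ∧
          HasGradientAt (supEnv Φ h C lam) (lam⁻¹ • (pair x z - p)) (pair x z)) :=
  mainTheorem3_general P hm ξ hξ f hf_cont hf_nonneg hf_density L hL C hC_compact hC_convex
    (nonempty_of_closure_coneOf hC_gen) Φ h hh_smooth hΦ_convex xbar hxbar hf_growth lam hlam
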